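/- Let $(X_0,X_1)$ be a compatible couple of Banach spaces, i.e. $X_0$ and $X_1$ are continuously embedded in a common Hausdorff topological vector space. For $t>0$ put $K(f,t)=\inf\{\|f_0\|_{X_0}+t\|f_1\|_{X_1} : f=f_0+f_1,\ f_0\in X_0,\ f_1\in X_1\}$ for $f\in X_0+X_1$, and $J(f,t)=\max\{\|f\|_{X_0},t\|f\|_{X_1}\}$ for $f\in X_0\cap X_1$. For a measurable weight $v$ on $(0,\infty)$ that is finite and non-negative almost everywhere, let $$(X_0,X_1)_{0,1,v;K}=\Big\{f\in X_0+X_1:\ \|f\|_{0,1,v;K}:=\int_0^\infty v(t)K(f,t)\,\frac{dt}{t}<\infty\Big\},$$ and let $(X_0,X_1)_{0,1,v;J}$ be the space of all $f\in X_0+X_1$ for which $$\|f\|_{0,1,v;J}:=\inf_u\int_0^\infty v(t)J(u(t),t)\,\frac{dt}{t}<\infty,$$ where the infimum is over all strongly measurable $u:(0,\infty)\to X_0\cap X_1$ such that $f=\int_0^\infty u(s)\,\frac{ds}{s}$ with (Bochner) convergence in $X_0+X_1$ (and is $\infty$ if there is no such $u$). A positive, finite, Lebesgue measurable function $b$ on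 $(0,\infty)$ is slowly varying, $b\in SV(0,\infty)$, if for every $\varepsilon>0$ the function $t^{\varepsilon}b(t)$ is equivalent (up to positive multiplicative constants) to a non-decreasing function on $(0,\infty)$ and $t^{-\varepsilon}b(t)$ is equivalent to a non-increasing function on $(0,\infty)$. Write $b\in AC(0,\infty)$ if $b$ is absolutely continuous on every compact subinterval of $(0,\infty)$. Let $a,\alpha\in SV(0,\infty)\cap AC(0,\infty)$ be strictly decreasing with $$\lim_{t\to0+}a(t)=\infty,\quad \lim_{t\to\infty}a(t)>0,\qquad \lim_{t\to0+}\alpha(t)=\infty,\quad \lim_{t\to\infty}\alpha(t)=0.$$ Put $A(x)=a(x)$ for $x\in(0,1]$ and $A(x)=c\,\alpha(x)$ for $x\in(1,\infty)$, where $c>0$ is a constant chosen so that $A\in AC(0,\infty)$, and let $B(x)=-x\,A'(x)$ for almost every $x>0$. Then $$(X_0,X_1)_{0,1,a;J}=X_0\cap(X_0,X_1)_{0,1,A;J}=X_0\cap(X_0,X_1)_{0,1,B;K},$$ where equality means that the spaces are equal as sets and their norms are equivalent, and $X_0\cap Y$ carries the norm $\max\{\|f\|_{X_0},\|f\|_Y\}$.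 -/

import Mathlib

open MeasureTheory Set Filter Topology
open scoped ENNReal

noncomputable section

/-- A function `b`, of which only the values on `(0,∞)` matter, is slowly varying on `(0,∞)`:
it is positive (and finite) and Lebesgue measurable there and, for every `ε > 0`, the function
`t ^ ε * b t` is equivalent to a non-decreasing function and `t ^ (-ε) * b t` is equivalent to a
non-increasing function on `(0,∞)`. -/
structure SlowlyVarying (b : ℝ → ℝ) : Prop where
  pos : ∀ t, 0 < t → 0 < b t
  aemeasurable : AEMeasurable b (volume.restrict (Ioi (0 : ℝ)))
  equiv_monotone : ∀ ε : ℝ, 0 < ε → ∃ g : ℝ → ℝ, MonotoneOn g (Ioi 0) ∧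
    ∃ c C : ℝ, 0 < c ∧ 0 < C ∧ ∀ t, 0 < t → c * g t ≤ t ^ ε * b t ∧ t ^ ε * b t ≤ C * g t
  equiv_antitone : ∀ ε : ℝ, 0 < ε → ∃ g : ℝ → ℝ, AntitoneOn g (Ioi 0) ∧
    ∃ c C : ℝ, 0 < c ∧ 0 < C ∧ ∀ t, 0 < t → c * g t ≤ t ^ (-ε) * b t ∧ t ^ (-ε) * b t ≤ C * g t

/-- (Local) absolute continuity on the open interval `(0,∞)`: absolute continuity on each compact
subinterval. (Functions with limit `∞` at `0` are meant to be allowed.) -/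
def LocallyAbsolutelyContinuous (f : ℝ → ℝ) : Prop :=
  ∀ x y : ℝ, 0 < x → x ≤ y → AbsolutelyContinuousOnInterval f x y

/-- A compatible couple: `X₀` and `X₁` are continuously embedded in the topological vector space
`E`, which is Hausdorff wherever this structure is used below. -/
structure CompatibleCouple (X₀ X₁ E : Type*)
    [NormedAddCommGroup X₀] [NormedSpace ℝ X₀] [NormedAddCommGroup X₁] [NormedSpace ℝ X₁]
    [AddCommGroup E] [Module ℝ E] [TopologicalSpace E] where
  i₀ : X₀ →L[ℝ] E
  i₁ : X₁ →L[ℝ] E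
  injective₀ : Function.Injective i₀
  injective₁ : Function.Injective i₁

namespace CompatibleCouple

variable {X₀ X₁ E : Type*}
  [NormedAddCommGroup X₀] [NormedSpace ℝ X₀] [NormedAddCommGroup X₁] [NormedSpace ℝ X₁]
  [AddCommGroup E] [Module ℝ E] [TopologicalSpace E] [IsTopologicalAddGroup E]

/-- The addition map `(x, y) ↦ x + y` from the `ℓ¹`-sum of `X₀` and `X₁` to the ambient space. -/
def addMap (C : CompatibleCouple X₀ X₁ E) : WithLp 1 (X₀ × X₁) →L[ℝ] E :=
  (C.i₀.coprod C.i₁).comp (WithLp.prodContinuousLinearEquiv 1 ℝ X₀ X₁).toContinuousLinearMap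

/-- The pairs `(x, y)` with `x + y = 0`. -/
def addKer (C : CompatibleCouple X₀ X₁ E) : Submodule ℝ (WithLp 1 (X₀ × X₁)) :=
  LinearMap.ker C.addMap.toLinearMap

/-- The space `X₀ + X₁`, as the space of pairs `(x, y)` modulo `x + y = 0`. Its (quotient) norm is
`inf {‖x‖ + ‖y‖ : f = x + y}`. -/
abbrev Sum (C : CompatibleCouple X₀ X₁ E) : Type _ := WithLp 1 (X₀ × X₁) ⧸ C.addKer

/-- The element `x + y` of `X₀ + X₁`. -/
def add (C : CompatibleCouple X₀ X₁ E) (x : X₀) (y : X₁) : C.Sum :=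
  C.addKer.mkQ (WithLp.toLp 1 (x, y))

/-- Two elements of `X₀ + X₁` are equal if and only if they are equal in the ambient space. -/
theorem add_eq_add_iff (C : CompatibleCouple X₀ X₁ E) (x x' : X₀) (y y' : X₁) :
    C.add x y = C.add x' y' ↔ C.i₀ x + C.i₁ y = C.i₀ x' + C.i₁ y' := by
  unfold add
  rw [Submodule.mkQ_apply, Submodule.mkQ_apply, Submodule.Quotient.eq, addKer, LinearMap.mem_ker,
    map_sub, sub_eq_zero]
  simp [addMap]

variable [T2Space E]

instance isClosed_addKer (C : CompatibleCouple X₀ X₁ E) :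
    IsClosed (C.addKer : Set (WithLp 1 (X₀ × X₁))) :=
  isClosed_singleton.preimage C.addMap.continuous

/-- The space `X₀ ∩ X₁`, as the space of pairs `(x, y)` with `x = y` in the ambient space, with the
norm `max ‖x‖ ‖y‖`. -/
abbrev Inter (C : CompatibleCouple X₀ X₁ E) : Type _ :=
  ((C.i₀.comp (ContinuousLinearMap.fst ℝ X₀ X₁)).toLinearMap.eqLocus
    (C.i₁.comp (ContinuousLinearMap.snd ℝ X₀ X₁)).toLinearMap : Submodule ℝ (X₀ × X₁))

/-- The inclusion of `X₀ ∩ X₁` in `X₀ + X₁`. -/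
def interToSum (C : CompatibleCouple X₀ X₁ E) (p : C.Inter) : C.Sum :=
  C.add p.1.1 0

/-- The `K`-functional `K(f,t;X₀,X₁)`. -/
def kFun (C : CompatibleCouple X₀ X₁ E) (f : C.Sum) (t : ℝ) : ℝ :=
  sInf {r : ℝ | ∃ (x : X₀) (y : X₁), C.add x y = f ∧ r = ‖x‖ + t * ‖y‖}

/-- The `J`-functional `J(f,t;X₀,X₁)`. -/
def jFun (C : CompatibleCouple X₀ X₁ E) (p : C.Inter) (t : ℝ) : ℝ :=
  max ‖p.1.1‖ (t * ‖p.1.2‖)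

/-- The norm of the space `(X₀,X₁)_{θ,q,v;K}`, extended by the value `∞` to all of `X₀ + X₁`. -/
def kNorm (C : CompatibleCouple X₀ X₁ E) (θ : ℝ) (q : ℝ≥0∞) (v : ℝ → ℝ) (f : C.Sum) : ℝ≥0∞ :=
  eLpNorm (fun t : ℝ => t ^ (-θ - 1 / q.toReal) * v t * C.kFun f t) q (volume.restrict (Ioi 0))

/-- `u` is strongly measurable on `(0,∞)` with values in `X₀ ∩ X₁`, and `f = ∫₀^∞ u(s) ds/s` with
convergence (as a Bochner integral) in `X₀ + X₁`. -/
def IsRepresentation (C : CompatibleCouple X₀ X₁ E) (u : ℝ → C.Inter) (f : C.Sum) : Prop :=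
  AEStronglyMeasurable u (volume.restrict (Ioi 0)) ∧
  IntegrableOn (fun s : ℝ => s⁻¹ • C.interToSum (u s)) (Ioi 0) ∧
  ∫ s in Ioi (0 : ℝ), s⁻¹ • C.interToSum (u s) = f

/-- The norm of the space `(X₀,X₁)_{θ,q,v;J}`, extended by the value `∞` to all of `X₀ + X₁` (in
particular it is `∞` at an `f` that has no representation). -/
def jNorm (C : CompatibleCouple X₀ X₁ E) (θ : ℝ) (q : ℝ≥0∞) (v : ℝ → ℝ) (f : C.Sum) : ℝ≥0∞ :=
  ⨅ (u : ℝ → C.Inter) (_ : C.IsRepresentation u f),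
    eLpNorm (fun t : ℝ => t ^ (-θ - 1 / q.toReal) * v t * C.jFun (u t) t) q
      (volume.restrict (Ioi 0))

/-- The norm of `X₀`, extended by the value `∞` to all of `X₀ + X₁`. -/
def norm₀ (C : CompatibleCouple X₀ X₁ E) (f : C.Sum) : ℝ≥0∞ :=
  ⨅ (x : X₀) (_ : C.add x 0 = f), ‖x‖ₑ

/-- The norm of `X₀ ∩ Y`, for the subspace `Y` of `X₀ + X₁` on which the extended norm `N` is
finite. -/
def interNorm₀ (C : CompatibleCouple X₀ X₁ E) (N : C.Sum → ℝ≥0∞) (f : C.Sum) : ℝ≥0∞ :=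
  max (C.norm₀ f) (N f)

end CompatibleCouple

/-- The space on which an extended norm is finite. -/
def finiteSpace {V : Type*} (N : V → ℝ≥0∞) : Set V := {f | N f < ∞}

/-- The spaces given by two extended norms coincide: they are equal as sets, and their norms are
equivalent. -/
def Coincide {V : Type*} (N M : V → ℝ≥0∞) : Prop :=
  finiteSpace N = finiteSpace M ∧
  ∃ c C : ℝ, 0 < c ∧ 0 < C ∧
    ∀ f ∈ finiteSpace N, ENNReal.ofReal c * N f ≤ M f ∧ M f ≤ ENNReal.ofReal C * N f

end

/-! Everything reduces to four inequalities, for f ∈ X₀ where needed. The only quantitative input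
from slow variation is √r·A(r) ≤ c·√s·A(s) for r ≤ s.

Since a is bounded below by l > 0 and A ≲ a, the a-weighted J-norm dominates both the norm of X₀ and
the A-weighted J-norm.

From J to K (`kNorm_le_mul_jNorm`): cutting f = ∫ u(s) ds/s at s = t gives K(f,t) ≤ ∫ min(1, t/s)
J(u(s),s) ds/s. Integrating against B(t) dt/t = -A'(t) dt and exchanging integrals leaves ∫ -A'(t)
min(t,s) dt ≤ ∫₀ˢ A ≤ 2c·s·A(s).

From K to J (`jNorm_incl₀_le_mul_kNorm`): choose t_k with A(t_k) = 2c·A(t_{k+1}), and nearly optimal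
splittings f = x_k + y_k at t_k. The K-norm controls ∑ A(t_k) K(f,t_k), because A drops by at least
half of A(t_k) between consecutive levels. The differences x_{k+1} - x_k = y_k - y_{k+1} lie in X₀ ∩
X₁, have J-functional at most 4K(f,t_{k+1}) at t_k, and telescope to f: x_k → 0 at -∞ by finiteness
of the sum, y_k → 0 at +∞ because K(f,·) is bounded for f ∈ X₀. Spreading them over disjoint windows
gives a continuous representation.

For the weight a (`jNorm_incl₀_le_add`) the same series is cut off after level t_0 = 1, where a and
A part: the remainder of f is put into X₀ in one piece, at a cost of a multiple of ‖f‖ in X₀. -/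

set_option linter.unusedSectionVars false

namespace CompatibleCouple

/-! ### Elementary properties of the sum space and of the K- and J-functionals -/

section Functionals

variable {X₀ X₁ E : Type*}
  [NormedAddCommGroup X₀] [NormedSpace ℝ X₀] [NormedAddCommGroup X₁] [NormedSpace ℝ X₁]
  [AddCommGroup E] [Module ℝ E] [TopologicalSpace E] [IsTopologicalAddGroup E]
  (C : CompatibleCouple X₀ X₁ E)

theorem exists_add_eq (f : C.Sum) : ∃ x y, C.add x y = f := by
  obtain ⟨p, rfl⟩ := Submodule.Quotient.mk_surjective _ f
  exact ⟨p.fst, p.snd, rfl⟩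

theorem add_add (x x' : X₀) (y y' : X₁) :
    C.add (x + x') (y + y') = C.add x y + C.add x' y' := by
  unfold add
  rw [← map_add, ← WithLp.toLp_add, Prod.mk_add_mk]

theorem add_smul (r : ℝ) (x : X₀) (y : X₁) : C.add (r • x) (r • y) = r • C.add x y := by
  unfold add
  rw [← map_smul, ← WithLp.toLp_smul, Prod.smul_mk]

theorem add_zero_zero : C.add 0 0 = 0 := by
  simpa using C.add_smul 0 0 0

theorem norm_add_le_add_norm (x : X₀) (y : X₁) : ‖C.add x y‖ ≤ ‖x‖ + ‖y‖ := by
  refine (Submodule.Quotient.norm_mk_le C.addKer _).trans ?_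
  rw [WithLp.prod_norm_eq_of_nat 1 (by norm_num)]
  simp

/-- The inclusion of `X₀` in `X₀ + X₁`. -/
noncomputable def incl₀ : X₀ →L[ℝ] C.Sum :=
  LinearMap.mkContinuous
    { toFun := fun x => C.add x 0
      map_add' := fun x y => by rw [← C.add_add, add_zero]
      map_smul' := fun r x => by simp [← C.add_smul] } 1
    (fun x => by simpa using C.norm_add_le_add_norm x 0)

/-- The inclusion of `X₁` in `X₀ + X₁`. -/
noncomputable def incl₁ : X₁ →L[ℝ] C.Sum :=
  LinearMap.mkContinuous
    { toFun := fun y => C.add 0 y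
      map_add' := fun x y => by rw [← C.add_add, add_zero]
      map_smul' := fun r x => by simp [← C.add_smul] } 1
    (fun x => by simpa using C.norm_add_le_add_norm 0 x)

theorem incl₀_apply (x : X₀) : C.incl₀ x = C.add x 0 := rfl

theorem incl₁_apply (y : X₁) : C.incl₁ y = C.add 0 y := rfl

theorem add_eq_incl (x : X₀) (y : X₁) : C.add x y = C.incl₀ x + C.incl₁ y := by
  rw [incl₀_apply, incl₁_apply, ← C.add_add, add_zero, zero_add]

theorem incl₀_injective : Function.Injective C.incl₀ := by
  intro x x' h
  have h' := (C.add_eq_add_iff _ _ _ _).1 h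
  exact C.injective₀ (by simpa using h')

theorem interToSum_eq_incl₀ (p : C.Inter) : C.interToSum p = C.incl₀ p.1.1 := rfl

theorem interToSum_eq_incl₁ (p : C.Inter) : C.interToSum p = C.incl₁ p.1.2 := by
  rw [interToSum, incl₁_apply, add_eq_add_iff]
  have h : C.i₀ p.1.1 = C.i₁ p.1.2 := p.2
  simp [h]

theorem interToSum_smul (r : ℝ) (p : C.Inter) : C.interToSum (r • p) = r • C.interToSum p := by
  simp only [interToSum_eq_incl₀, ← map_smul]
  rfl

theorem continuous_interToSum : Continuous C.interToSum :=
  C.incl₀.continuous.comp (continuous_fst.comp continuous_subtype_val)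

theorem norm₀_incl₀ (x : X₀) : C.norm₀ (C.incl₀ x) = ‖x‖ₑ := by
  refine le_antisymm (iInf₂_le (f := fun x' (_ : C.add x' 0 = C.incl₀ x) => ‖x'‖ₑ) x rfl) (le_iInf₂ fun x' hx' => ?_)
  rw [C.incl₀_injective hx']

theorem exists_incl₀_eq_of_norm₀_ne_top {f : C.Sum} (hf : C.norm₀ f ≠ ∞) : ∃ x, C.incl₀ x = f := by
  contrapose! hf
  simp only [norm₀, iInf_eq_top]
  exact fun x hx => absurd hx (hf x)

theorem kFun_bddBelow (f : C.Sum) {t : ℝ} (ht : 0 ≤ t) :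
    BddBelow {r : ℝ | ∃ (x : X₀) (y : X₁), C.add x y = f ∧ r = ‖x‖ + t * ‖y‖} :=
  ⟨0, by rintro r ⟨x, y, -, rfl⟩; positivity⟩

theorem kFun_add_le (x : X₀) (y : X₁) {t : ℝ} (ht : 0 ≤ t) :
    C.kFun (C.add x y) t ≤ ‖x‖ + t * ‖y‖ :=
  csInf_le (C.kFun_bddBelow _ ht) ⟨x, y, rfl, rfl⟩

theorem kFun_incl₀_le (x : X₀) {t : ℝ} (ht : 0 ≤ t) : C.kFun (C.incl₀ x) t ≤ ‖x‖ := by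
  have h := C.kFun_add_le x 0 ht
  rwa [norm_zero, mul_zero, _root_.add_zero] at h

theorem le_kFun {f : C.Sum} {t r : ℝ} (h : ∀ x y, C.add x y = f → r ≤ ‖x‖ + t * ‖y‖) :
    r ≤ C.kFun f t := by
  obtain ⟨x, y, hxy⟩ := C.exists_add_eq f
  refine le_csInf ⟨_, x, y, hxy, rfl⟩ ?_
  rintro r ⟨x, y, h', rfl⟩
  exact h x y h'

theorem kFun_nonneg (f : C.Sum) {t : ℝ} (ht : 0 ≤ t) : 0 ≤ C.kFun f t :=
  C.le_kFun fun x y _ => by positivity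

theorem kFun_mono (f : C.Sum) {s t : ℝ} (hs : 0 ≤ s) (hst : s ≤ t) : C.kFun f s ≤ C.kFun f t := by
  refine C.le_kFun fun x y h => ?_
  subst h
  refine (C.kFun_add_le x y hs).trans ?_
  gcongr

theorem min_mul_norm_le_kFun (f : C.Sum) {t : ℝ} (ht : 0 < t) : min 1 t * ‖f‖ ≤ C.kFun f t := by
  refine C.le_kFun fun x y h => ?_
  subst h
  have h0 : 0 ≤ min 1 t := le_min zero_le_one ht.le
  calc min 1 t * ‖C.add x y‖ ≤ min 1 t * (‖x‖ + ‖y‖) := by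
        gcongr; exact C.norm_add_le_add_norm x y
    _ = min 1 t * ‖x‖ + min 1 t * ‖y‖ := by ring
    _ ≤ 1 * ‖x‖ + t * ‖y‖ := by
        gcongr
        · exact min_le_left _ _
        · exact min_le_right _ _
    _ = _ := by rw [one_mul]

theorem jFun_nonneg (p : C.Inter) (t : ℝ) : 0 ≤ C.jFun p t := (norm_nonneg _).trans (le_max_left _ _)

theorem jFun_smul (r : ℝ) (p : C.Inter) (t : ℝ) : C.jFun (r • p) t = |r| * C.jFun p t := by
  have h₀ : (r • p).1.1 = r • p.1.1 := rfl
  have h₁ : (r • p).1.2 = r • p.1.2 := rfl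
  rw [jFun, jFun, h₀, h₁, norm_smul, norm_smul, Real.norm_eq_abs, mul_max_of_nonneg _ _ (abs_nonneg r)]
  ring_nf

theorem jFun_le_two_mul (p : C.Inter) {s t : ℝ} (ht : t ≤ 2 * s) :
    C.jFun p t ≤ 2 * C.jFun p s := by
  have h₀ : ‖p.1.1‖ ≤ C.jFun p s := le_max_left _ _
  have h₁ : s * ‖p.1.2‖ ≤ C.jFun p s := le_max_right _ _
  refine max_le ?_ ?_
  · linarith [norm_nonneg p.1.1]
  · nlinarith [norm_nonneg p.1.2]

/-- The factor min(1, 1/t) fixes how small a weight may be while finite J-integrals still force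
convergence in X₀ + X₁. -/
theorem norm_interToSum_le (p : C.Inter) {t : ℝ} (ht : 0 < t) :
    ‖C.interToSum p‖ ≤ min 1 t⁻¹ * C.jFun p t := by
  have h₀ : ‖C.interToSum p‖ ≤ ‖p.1.1‖ := by
    have h := C.norm_add_le_add_norm p.1.1 0
    rwa [norm_zero, _root_.add_zero] at h
  have h₁ : ‖C.interToSum p‖ ≤ ‖p.1.2‖ := by
    have h := C.norm_add_le_add_norm 0 p.1.2
    rwa [norm_zero, _root_.zero_add, ← incl₁_apply, ← interToSum_eq_incl₁] at h
  rw [min_mul_of_nonneg _ _ (C.jFun_nonneg p t), one_mul]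
  refine le_min (h₀.trans (le_max_left _ _)) (h₁.trans ?_)
  rw [← div_eq_inv_mul, le_div_iff₀' ht]
  exact le_max_right _ _

end Functionals

section Separated

variable {X₀ X₁ E : Type*}
  [NormedAddCommGroup X₀] [NormedSpace ℝ X₀] [NormedAddCommGroup X₁] [NormedSpace ℝ X₁]
  [AddCommGroup E] [Module ℝ E] [TopologicalSpace E] [IsTopologicalAddGroup E] [T2Space E]
  (C : CompatibleCouple X₀ X₁ E)

/-- The infimum need not be attained, hence the factor 2. For f ≠ 0 it is positive because the
kernel is closed, so that the quotient seminorm is a norm. -/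
theorem exists_norm_le_two_mul_kFun (f : C.Sum) {t : ℝ} (ht : 0 < t) :
    ∃ x y, C.add x y = f ∧ ‖x‖ + t * ‖y‖ ≤ 2 * C.kFun f t := by
  rcases eq_or_ne f 0 with rfl | hf
  · exact ⟨0, 0, C.add_zero_zero, by simpa using C.kFun_nonneg 0 ht.le⟩
  have hpos : 0 < C.kFun f t :=
    (mul_pos (lt_min one_pos ht) (norm_pos_iff.2 hf)).trans_le (C.min_mul_norm_le_kFun f ht)
  by_contra! h
  linarith [C.le_kFun fun x y hxy => (h x y hxy).le]

end Separated

end CompatibleCouple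

namespace CompatibleCouple

/-! ### Estimates from an integral representation -/

section UpperBounds

variable {X₀ X₁ E : Type*}
  [NormedAddCommGroup X₀] [NormedSpace ℝ X₀] [NormedAddCommGroup X₁] [NormedSpace ℝ X₁]
  [AddCommGroup E] [Module ℝ E] [TopologicalSpace E] [IsTopologicalAddGroup E]
  (C : CompatibleCouple X₀ X₁ E)

/-- The density `J(u(s),s)/s`. -/
noncomputable def jDensity (u : ℝ → C.Inter) (s : ℝ) : ℝ≥0∞ := ENNReal.ofReal (s⁻¹ * C.jFun (u s) s)

theorem aemeasurable_jDensity {u : ℝ → C.Inter}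
    (hu : AEStronglyMeasurable u (volume.restrict (Ioi 0))) :
    AEMeasurable (C.jDensity u) (volume.restrict (Ioi 0)) := by
  have h₀ : AEMeasurable (fun s => ‖(u s).1.1‖) (volume.restrict (Ioi 0)) :=
    ((by fun_prop : Continuous fun p : C.Inter => ‖p.1.1‖).comp_aestronglyMeasurable hu).aemeasurable
  have h₁ : AEMeasurable (fun s => ‖(u s).1.2‖) (volume.restrict (Ioi 0)) :=
    ((by fun_prop : Continuous fun p : C.Inter => ‖p.1.2‖).comp_aestronglyMeasurable hu).aemeasurable
  unfold jDensity jFun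
  fun_prop

theorem eLpNorm_jFun_eq_lintegral {v : ℝ → ℝ} (hv : ∀ t, 0 < t → 0 ≤ v t) (u : ℝ → C.Inter) :
    eLpNorm (fun t : ℝ => t ^ (-0 - 1 / (1 : ℝ≥0∞).toReal) * v t * C.jFun (u t) t) 1
      (volume.restrict (Ioi 0)) = ∫⁻ t in Ioi 0, ENNReal.ofReal (v t) * C.jDensity u t := by
  rw [eLpNorm_one_eq_lintegral_enorm]
  refine setLIntegral_congr_fun measurableSet_Ioi fun t (ht : 0 < t) => ?_
  have hJ := C.jFun_nonneg (u t) t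
  have hv' := hv t ht
  simp only [jDensity]
  rw [← ENNReal.ofReal_mul hv', ENNReal.toReal_one, neg_zero, zero_sub, div_one, Real.rpow_neg_one,
    Real.enorm_of_nonneg (by positivity)]
  congr 1
  ring

theorem enorm_smul_fst_le (u : ℝ → C.Inter) {s : ℝ} (hs : 0 < s) :
    ‖s⁻¹ • (u s).1.1‖ₑ ≤ C.jDensity u s := by
  rw [← ofReal_norm, norm_smul, norm_inv, Real.norm_of_nonneg hs.le]
  refine ENNReal.ofReal_le_ofReal ?_
  gcongr
  exact le_max_left _ _

theorem enorm_smul_snd_le (u : ℝ → C.Inter) {s t : ℝ} (hs : 0 < s) (ht : 0 < t) :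
    ENNReal.ofReal t * ‖s⁻¹ • (u s).1.2‖ₑ ≤ ENNReal.ofReal (t / s) * C.jDensity u s := by
  rw [← ofReal_norm, norm_smul, norm_inv, Real.norm_of_nonneg hs.le, jDensity,
    ← ENNReal.ofReal_mul ht.le, ← ENNReal.ofReal_mul (by positivity)]
  refine ENNReal.ofReal_le_ofReal ?_
  have h : s * ‖(u s).1.2‖ ≤ C.jFun (u s) s := le_max_right _ _
  calc t * (s⁻¹ * ‖(u s).1.2‖) = t / s * (s⁻¹ * (s * ‖(u s).1.2‖)) := by field_simp
    _ ≤ _ := by gcongr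

end UpperBounds

section Separated

variable {X₀ X₁ E : Type*}
  [NormedAddCommGroup X₀] [NormedSpace ℝ X₀] [CompleteSpace X₀]
  [NormedAddCommGroup X₁] [NormedSpace ℝ X₁] [CompleteSpace X₁]
  [AddCommGroup E] [Module ℝ E] [TopologicalSpace E] [IsTopologicalAddGroup E] [T2Space E]
  (C : CompatibleCouple X₀ X₁ E)

theorem exists_incl₀_eq_setIntegral {u : ℝ → C.Inter} {S : Set ℝ} (hS : S ⊆ Ioi 0)
    (hSm : MeasurableSet S) (hu : AEStronglyMeasurable u (volume.restrict (Ioi 0)))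
    (hfin : ∫⁻ s in S, C.jDensity u s ≠ ∞) :
    ∃ x : X₀, C.incl₀ x = ∫ s in S, s⁻¹ • C.interToSum (u s) ∧
      ‖x‖ₑ ≤ ∫⁻ s in S, C.jDensity u s := by
  have hle : ∀ᵐ s ∂(volume.restrict S), ‖s⁻¹ • (u s).1.1‖ₑ ≤ C.jDensity u s :=
    (ae_restrict_iff' hSm).2 <| .of_forall fun s hs => C.enorm_smul_fst_le u (hS hs)
  have hm : AEStronglyMeasurable (fun s : ℝ => s⁻¹ • (u s).1.1) (volume.restrict S) :=
    (measurable_inv.aestronglyMeasurable (f := fun s : ℝ => s⁻¹)).smul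
      ((by fun_prop : Continuous fun p : C.Inter => p.1.1).comp_aestronglyMeasurable
        (hu.mono_set hS))
  have hi : Integrable (fun s : ℝ => s⁻¹ • (u s).1.1) (volume.restrict S) :=
    ⟨hm, (lintegral_mono_ae hle).trans_lt hfin.lt_top⟩
  refine ⟨∫ s in S, s⁻¹ • (u s).1.1, ?_, ?_⟩
  · rw [← ContinuousLinearMap.integral_comp_comm _ hi]
    simp only [map_smul, interToSum_eq_incl₀]
  · exact (enorm_integral_le_lintegral_enorm _).trans (lintegral_mono_ae hle)

theorem exists_incl₁_eq_setIntegral {u : ℝ → C.Inter} {S : Set ℝ} (hS : S ⊆ Ioi 0)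
    (hSm : MeasurableSet S) (hu : AEStronglyMeasurable u (volume.restrict (Ioi 0)))
    {t : ℝ} (ht : 0 < t) (hfin : ∫⁻ s in S, ENNReal.ofReal (t / s) * C.jDensity u s ≠ ∞) :
    ∃ y : X₁, C.incl₁ y = ∫ s in S, s⁻¹ • C.interToSum (u s) ∧
      ENNReal.ofReal t * ‖y‖ₑ ≤ ∫⁻ s in S, ENNReal.ofReal (t / s) * C.jDensity u s := by
  have hle : ∀ᵐ s ∂(volume.restrict S), ENNReal.ofReal t * ‖s⁻¹ • (u s).1.2‖ₑ ≤
      ENNReal.ofReal (t / s) * C.jDensity u s :=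
    (ae_restrict_iff' hSm).2 <| .of_forall fun s hs => C.enorm_smul_snd_le u (hS hs) ht
  have hm : AEStronglyMeasurable (fun s : ℝ => s⁻¹ • (u s).1.2) (volume.restrict S) :=
    (measurable_inv.aestronglyMeasurable (f := fun s : ℝ => s⁻¹)).smul
      ((by fun_prop : Continuous fun p : C.Inter => p.1.2).comp_aestronglyMeasurable
        (hu.mono_set hS))
  have hlin : ENNReal.ofReal t * ∫⁻ s in S, ‖s⁻¹ • (u s).1.2‖ₑ ≤
      ∫⁻ s in S, ENNReal.ofReal (t / s) * C.jDensity u s := by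
    rw [← lintegral_const_mul' _ _ ENNReal.ofReal_ne_top]
    exact lintegral_mono_ae hle
  have hi : Integrable (fun s : ℝ => s⁻¹ • (u s).1.2) (volume.restrict S) := by
    refine ⟨hm, lt_top_iff_ne_top.2 fun htop => hfin ?_⟩
    rw [htop, ENNReal.mul_top (by simpa using ht)] at hlin
    exact top_le_iff.1 hlin
  refine ⟨∫ s in S, s⁻¹ • (u s).1.2, ?_, ?_⟩
  · rw [← ContinuousLinearMap.integral_comp_comm _ hi]
    simp only [map_smul, interToSum_eq_incl₁]
  · refine le_trans ?_ hlin
    gcongr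
    exact enorm_integral_le_lintegral_enorm _

theorem norm₀_le_lintegral_jDensity {u : ℝ → C.Inter} {f : C.Sum} (hu : C.IsRepresentation u f) :
    C.norm₀ f ≤ ∫⁻ s in Ioi 0, C.jDensity u s := by
  by_cases hfin : ∫⁻ s in Ioi 0, C.jDensity u s = ∞
  · exact hfin ▸ le_top
  obtain ⟨x, hx, hle⟩ := C.exists_incl₀_eq_setIntegral subset_rfl measurableSet_Ioi hu.1 hfin
  rw [hu.2.2] at hx
  rwa [← hx, norm₀_incl₀]

/-- Cut the representation at s = t: the part s ≤ t converges in X₀, the part s > t in X₁ with the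
factor t/s, and min(1, t/s) records both. -/
theorem kFun_le_lintegral_jDensity {u : ℝ → C.Inter} {f : C.Sum} (hu : C.IsRepresentation u f)
    {t : ℝ} (ht : 0 < t) :
    ENNReal.ofReal (C.kFun f t) ≤
      ∫⁻ s in Ioi 0, ENNReal.ofReal (min 1 (t / s)) * C.jDensity u s := by
  have hsplit : Ioi (0 : ℝ) = Ioc 0 t ∪ Ioi t := (Ioc_union_Ioi_eq_Ioi ht.le).symm
  have hdisj : Disjoint (Ioc 0 t) (Ioi t) := Ioc_disjoint_Ioi_same
  have hsub₁ : Ioi t ⊆ Ioi (0 : ℝ) := Ioi_subset_Ioi ht.le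
  have h₀ : ∫⁻ s in Ioc 0 t, ENNReal.ofReal (min 1 (t / s)) * C.jDensity u s =
      ∫⁻ s in Ioc 0 t, C.jDensity u s :=
    setLIntegral_congr_fun measurableSet_Ioc fun s hs => by
      simp only [min_eq_left ((one_le_div hs.1).2 hs.2), ENNReal.ofReal_one, one_mul]
  have h₁ : ∫⁻ s in Ioi t, ENNReal.ofReal (min 1 (t / s)) * C.jDensity u s =
      ∫⁻ s in Ioi t, ENNReal.ofReal (t / s) * C.jDensity u s :=
    setLIntegral_congr_fun measurableSet_Ioi fun s (hs : t < s) => by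
      simp only [min_eq_right ((div_le_one (ht.trans hs)).2 hs.le)]
  have hsum : ∫⁻ s in Ioi 0, ENNReal.ofReal (min 1 (t / s)) * C.jDensity u s =
      (∫⁻ s in Ioc 0 t, C.jDensity u s) +
        ∫⁻ s in Ioi t, ENNReal.ofReal (t / s) * C.jDensity u s := by
    rw [hsplit, lintegral_union measurableSet_Ioi hdisj, h₀, h₁]
  rw [hsum]
  by_cases hfin₀ : ∫⁻ s in Ioc 0 t, C.jDensity u s = ∞
  · simp [hfin₀]
  by_cases hfin₁ : ∫⁻ s in Ioi t, ENNReal.ofReal (t / s) * C.jDensity u s = ∞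
  · simp [hfin₁]
  obtain ⟨x, hx, hxle⟩ := C.exists_incl₀_eq_setIntegral Ioc_subset_Ioi_self measurableSet_Ioc
    hu.1 hfin₀
  obtain ⟨y, hy, hyle⟩ := C.exists_incl₁_eq_setIntegral hsub₁ measurableSet_Ioi hu.1 ht hfin₁
  have hf : f = C.add x y := by
    rw [add_eq_incl, hx, hy, ← setIntegral_union hdisj measurableSet_Ioi
      (hu.2.1.mono_set Ioc_subset_Ioi_self) (hu.2.1.mono_set hsub₁), ← hsplit, hu.2.2]
  calc ENNReal.ofReal (C.kFun f t) ≤ ENNReal.ofReal (‖x‖ + t * ‖y‖) :=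
        ENNReal.ofReal_le_ofReal (hf ▸ C.kFun_add_le x y ht.le)
    _ = ‖x‖ₑ + ENNReal.ofReal t * ‖y‖ₑ := by
        rw [ENNReal.ofReal_add (by positivity) (by positivity), ENNReal.ofReal_mul ht.le,
          ofReal_norm, ofReal_norm]
    _ ≤ _ := add_le_add hxle hyle

theorem jNorm_le_lintegral {v : ℝ → ℝ} (hv : ∀ t, 0 < t → 0 ≤ v t) {f : C.Sum} {u : ℝ → C.Inter}
    (hu : C.IsRepresentation u f) :
    C.jNorm 0 1 v f ≤ ∫⁻ t in Ioi 0, ENNReal.ofReal (v t) * C.jDensity u t := by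
  rw [← C.eLpNorm_jFun_eq_lintegral hv]
  exact iInf₂_le u hu

/-- Positivity of c matters when f has no representation: the right side must then be ∞, not 0·∞ =
0. -/
theorem le_mul_jNorm {v : ℝ → ℝ} (hv : ∀ t, 0 < t → 0 ≤ v t) {f : C.Sum} {c : ℝ} (hc : 0 < c)
    {r : ℝ≥0∞} (h : ∀ u, C.IsRepresentation u f →
      r ≤ ENNReal.ofReal c * ∫⁻ t in Ioi 0, ENNReal.ofReal (v t) * C.jDensity u t) :
    r ≤ ENNReal.ofReal c * C.jNorm 0 1 v f := by
  have hc' : ENNReal.ofReal c ≠ 0 := by simpa using hc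
  unfold jNorm
  simp only [C.eLpNorm_jFun_eq_lintegral hv, ENNReal.mul_iInf_of_ne hc' ENNReal.ofReal_ne_top]
  exact le_iInf₂ h

theorem jNorm_le_mul_jNorm {v w : ℝ → ℝ} (hv : ∀ t, 0 < t → 0 ≤ v t) (hw : ∀ t, 0 < t → 0 ≤ w t)
    {c : ℝ} (hc : 0 < c) (hvw : ∀ t, 0 < t → v t ≤ c * w t) (f : C.Sum) :
    C.jNorm 0 1 v f ≤ ENNReal.ofReal c * C.jNorm 0 1 w f := by
  refine C.le_mul_jNorm hw hc fun u hu => (C.jNorm_le_lintegral hv hu).trans ?_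
  rw [← lintegral_const_mul' _ _ ENNReal.ofReal_ne_top]
  refine setLIntegral_mono' measurableSet_Ioi fun t ht => ?_
  rw [← mul_assoc, ← ENNReal.ofReal_mul hc.le]
  gcongr
  exact hvw t ht

theorem norm₀_le_mul_jNorm {v : ℝ → ℝ} {c : ℝ} (hc : 0 < c) (hv : ∀ t, 0 < t → 1 ≤ c * v t)
    (f : C.Sum) : C.norm₀ f ≤ ENNReal.ofReal c * C.jNorm 0 1 v f := by
  have hv' : ∀ t, 0 < t → 0 ≤ v t := fun t ht =>
    (pos_of_mul_pos_right (one_pos.trans_le (hv t ht)) hc.le).le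
  refine C.le_mul_jNorm hv' hc fun u hu => (C.norm₀_le_lintegral_jDensity hu).trans ?_
  rw [← lintegral_const_mul' _ _ ENNReal.ofReal_ne_top]
  refine setLIntegral_mono' measurableSet_Ioi fun t ht => ?_
  rw [← mul_assoc, ← ENNReal.ofReal_mul hc.le]
  exact le_mul_of_one_le_left' (by simpa using hv t ht)

end Separated

end CompatibleCouple

/-! ### Integrals of a decreasing weight and of its derivative -/

section Weights

theorem deriv_nonpos_of_antitoneOn_Ioi {A : ℝ → ℝ} (hA : AntitoneOn A (Ioi 0)) {t : ℝ}
    (ht : 0 < t) : deriv A t ≤ 0 := by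
  rw [← derivWithin_of_mem_nhds (Ioi_mem_nhds ht)]
  exact hA.derivWithin_nonpos

theorem setLIntegral_Ioc_neg_deriv {A : ℝ → ℝ} (hA : AntitoneOn A (Ioi 0))
    (hac : LocallyAbsolutelyContinuous A) {r s : ℝ} (hr : 0 < r) (hrs : r ≤ s) :
    ∫⁻ t in Ioc r s, ENNReal.ofReal (-deriv A t) = ENNReal.ofReal (A r - A s) := by
  have h := hac r s hr hrs
  have hi : IntegrableOn (fun t => -deriv A t) (Ioc r s) :=
    ((intervalIntegrable_iff_integrableOn_Ioc_of_le hrs).1 h.intervalIntegrable_deriv).neg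
  rw [← ofReal_integral_eq_lintegral_ofReal hi
    ((ae_restrict_iff' measurableSet_Ioc).2 <| .of_forall fun t ht => ?_), integral_neg,
    ← intervalIntegral.integral_of_le hrs, h.integral_deriv_eq_sub, neg_sub]
  simpa using deriv_nonpos_of_antitoneOn_Ioi hA (hr.trans ht.1)

theorem setLIntegral_Ioi_neg_deriv_le {A : ℝ → ℝ} (hA : AntitoneOn A (Ioi 0))
    (hac : LocallyAbsolutelyContinuous A) (hpos : ∀ t, 0 < t → 0 ≤ A t) {r : ℝ} (hr : 0 < r) :
    ∫⁻ t in Ioi r, ENNReal.ofReal (-deriv A t) ≤ ENNReal.ofReal (A r) := by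
  have hU : Ioi r = ⋃ n : ℕ, Ioc r (r + n) := by
    ext t
    simp only [mem_Ioi, mem_iUnion, mem_Ioc]
    refine ⟨fun ht => ?_, fun ⟨_, ht, _⟩ => ht⟩
    obtain ⟨n, hn⟩ := exists_nat_ge (t - r)
    exact ⟨n, ht, by linarith⟩
  have hmono : Monotone fun n : ℕ => Ioc r (r + n) := fun m n hmn =>
    Ioc_subset_Ioc_right (by gcongr)
  rw [hU, setLIntegral_iUnion_of_directed _ hmono.directed_le]
  refine iSup_le fun n => ?_
  have hn : r ≤ r + n := by simp
  rw [setLIntegral_Ioc_neg_deriv hA hac hr hn]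
  exact ENNReal.ofReal_le_ofReal (by linarith [hpos (r + n) (hr.trans_le hn)])

/-- The hypothesis bounds A(r) by a constant times r^(-1/2), which is integrable at 0 with integral
2√s. -/
theorem setLIntegral_Ioo_ofReal_le {A : ℝ → ℝ} {c s : ℝ} (hs : 0 < s)
    (hA : ∀ r, 0 < r → r ≤ s → √r * A r ≤ c * (√s * A s)) :
    ∫⁻ r in Ioo 0 s, ENNReal.ofReal (A r) ≤ ENNReal.ofReal (2 * c * (s * A s)) := by
  set K : ℝ := c * (√s * A s) with hK
  have hpow : ∀ r : ℝ, 0 < r → r ^ (-(1 / 2) : ℝ) = (√r)⁻¹ := fun r hr => by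
    rw [Real.rpow_neg hr.le, Real.sqrt_eq_rpow]
  have hint : IntegrableOn (fun r : ℝ => r ^ (-(1 / 2) : ℝ)) (Ioo 0 s) := by
    rw [← integrableOn_Ioc_iff_integrableOn_Ioo, ← intervalIntegrable_iff_integrableOn_Ioc_of_le hs.le]
    exact intervalIntegral.intervalIntegrable_rpow' (by norm_num)
  have hval : ∫⁻ r in Ioo 0 s, ENNReal.ofReal (r ^ (-(1 / 2) : ℝ)) = ENNReal.ofReal (2 * √s) := by
    rw [← ofReal_integral_eq_lintegral_ofReal hint
      ((ae_restrict_iff' measurableSet_Ioo).2 <| .of_forall fun t ht => Real.rpow_nonneg ht.1.le _),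
      ← integral_Ioc_eq_integral_Ioo, ← intervalIntegral.integral_of_le hs.le,
      integral_rpow (Or.inl (by norm_num)), Real.sqrt_eq_rpow, Real.zero_rpow (by norm_num)]
    congr 1
    norm_num
    ring
  calc ∫⁻ r in Ioo 0 s, ENNReal.ofReal (A r)
      ≤ ∫⁻ r in Ioo 0 s, ENNReal.ofReal K * ENNReal.ofReal (r ^ (-(1 / 2) : ℝ)) := by
        refine setLIntegral_mono' measurableSet_Ioo fun r hr => ?_
        have hr' : 0 < √r := Real.sqrt_pos.2 hr.1
        rw [← ENNReal.ofReal_mul' (Real.rpow_nonneg hr.1.le _), hpow r hr.1]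
        refine ENNReal.ofReal_le_ofReal ?_
        rw [← div_eq_mul_inv, le_div_iff₀' hr']
        exact hA r hr.1 hr.2.le
    _ = ENNReal.ofReal K * ENNReal.ofReal (2 * √s) := by
        rw [lintegral_const_mul' _ _ ENNReal.ofReal_ne_top, hval]
    _ = ENNReal.ofReal (2 * c * (s * A s)) := by
        rw [← ENNReal.ofReal_mul' (by positivity)]
        congr 1
        calc K * (2 * √s) = 2 * c * (√s * √s * A s) := by rw [hK]; ring
          _ = _ := by rw [Real.mul_self_sqrt hs.le]

theorem lintegral_neg_deriv_mul_min_le {A : ℝ → ℝ} (hA : AntitoneOn A (Ioi 0))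
    (hac : LocallyAbsolutelyContinuous A) (hpos : ∀ t, 0 < t → 0 ≤ A t) {c s : ℝ} (hs : 0 < s)
    (hc : ∀ r, 0 < r → r ≤ s → √r * A r ≤ c * (√s * A s)) :
    ∫⁻ t in Ioi 0, ENNReal.ofReal (-deriv A t) * ENNReal.ofReal (min t s) ≤
      ENNReal.ofReal (2 * c * (s * A s)) := by
  have hD : Measurable fun t => ENNReal.ofReal (-deriv A t) :=
    (measurable_deriv A).neg.ennreal_ofReal
  -- Layer cake: min(t,s) is the length of {r ∈ (0,s) : r < t}. After Tonelli the inner integral is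
  -- ∫_r^∞ -A' ≤ A(r).
  have hlayer : ∀ t, ENNReal.ofReal (-deriv A t) * ENNReal.ofReal (min t s) =
      ∫⁻ r in Ioo 0 s, {p : ℝ × ℝ | p.2 < p.1}.indicator
        (fun p => ENNReal.ofReal (-deriv A p.1)) (t, r) := fun t => by
    have : (fun r => {p : ℝ × ℝ | p.2 < p.1}.indicator
        (fun p => ENNReal.ofReal (-deriv A p.1)) (t, r)) =
        (Iio t).indicator fun _ => ENNReal.ofReal (-deriv A t) := rfl
    rw [this, lintegral_indicator measurableSet_Iio, lintegral_const,
      Measure.restrict_restrict measurableSet_Iio, Measure.restrict_apply_univ, inter_comm,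
      Ioo_inter_Iio, Real.volume_Ioo, sub_zero, min_comm]
  simp only [hlayer]
  rw [lintegral_lintegral_swap]
  · refine le_trans (setLIntegral_mono' measurableSet_Ioo fun r hr => ?_)
      (setLIntegral_Ioo_ofReal_le hs hc)
    have : (fun t => {p : ℝ × ℝ | p.2 < p.1}.indicator
        (fun p => ENNReal.ofReal (-deriv A p.1)) (t, r)) =
        (Ioi r).indicator fun t => ENNReal.ofReal (-deriv A t) := rfl
    rw [this, lintegral_indicator measurableSet_Ioi, Measure.restrict_restrict measurableSet_Ioi,
      inter_eq_left.2 (Ioi_subset_Ioi hr.1.le)]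
    exact setLIntegral_Ioi_neg_deriv_le hA hac hpos hr.1
  · exact ((hD.comp measurable_fst).indicator
      (measurableSet_lt measurable_snd measurable_fst)).aemeasurable

end Weights

/-! ### The K-norm is bounded by the J-norm -/

namespace CompatibleCouple

variable {X₀ X₁ E : Type*}
  [NormedAddCommGroup X₀] [NormedSpace ℝ X₀]
  [NormedAddCommGroup X₁] [NormedSpace ℝ X₁]
  [AddCommGroup E] [Module ℝ E] [TopologicalSpace E] [IsTopologicalAddGroup E] [T2Space E]
  (C : CompatibleCouple X₀ X₁ E)

theorem kNorm_eq_lintegral_neg_deriv {A B : ℝ → ℝ} (hA : AntitoneOn A (Ioi 0))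
    (hB : ∀ᵐ x ∂(volume.restrict (Ioi (0 : ℝ))), B x = -(x * deriv A x)) (f : C.Sum) :
    C.kNorm 0 1 B f =
      ∫⁻ t in Ioi 0, ENNReal.ofReal (-deriv A t) * ENNReal.ofReal (C.kFun f t) := by
  rw [kNorm, eLpNorm_one_eq_lintegral_enorm]
  refine lintegral_congr_ae ?_
  filter_upwards [hB, ae_restrict_mem measurableSet_Ioi] with t hBt (ht : 0 < t)
  have hd : 0 ≤ -deriv A t := by simpa using deriv_nonpos_of_antitoneOn_Ioi hA ht
  have hK := C.kFun_nonneg f ht.le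
  rw [hBt, ← ENNReal.ofReal_mul hd, ENNReal.toReal_one, neg_zero, zero_sub, div_one,
    Real.rpow_neg_one, ← Real.enorm_of_nonneg (by positivity)]
  congr 1
  field_simp

theorem kNorm_le_mul_jNorm [CompleteSpace X₀] [CompleteSpace X₁] {A B : ℝ → ℝ}
    (hA : AntitoneOn A (Ioi 0)) (hac : LocallyAbsolutelyContinuous A)
    (hpos : ∀ t, 0 < t → 0 ≤ A t) {c : ℝ} (hc₀ : 0 < c)
    (hc : ∀ r s, 0 < r → r ≤ s → √r * A r ≤ c * (√s * A s))
    (hB : ∀ᵐ x ∂(volume.restrict (Ioi (0 : ℝ))), B x = -(x * deriv A x)) (f : C.Sum) :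
    C.kNorm 0 1 B f ≤ ENNReal.ofReal (2 * c) * C.jNorm 0 1 A f := by
  have hD : Measurable fun t => ENNReal.ofReal (-deriv A t) :=
    (measurable_deriv A).neg.ennreal_ofReal
  refine C.le_mul_jNorm hpos (by positivity) fun u hu => ?_
  rw [C.kNorm_eq_lintegral_neg_deriv hA hB, ← lintegral_const_mul' _ _ ENNReal.ofReal_ne_top]
  calc ∫⁻ t in Ioi 0, ENNReal.ofReal (-deriv A t) * ENNReal.ofReal (C.kFun f t)
      ≤ ∫⁻ t in Ioi 0, ∫⁻ s in Ioi 0, ENNReal.ofReal (-deriv A t) *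
          (ENNReal.ofReal (min 1 (t / s)) * C.jDensity u s) := by
        refine setLIntegral_mono' measurableSet_Ioi fun t ht => ?_
        rw [lintegral_const_mul' _ _ ENNReal.ofReal_ne_top]
        gcongr
        exact C.kFun_le_lintegral_jDensity hu ht
    _ = ∫⁻ s in Ioi 0, ∫⁻ t in Ioi 0, ENNReal.ofReal (-deriv A t) *
          (ENNReal.ofReal (min 1 (t / s)) * C.jDensity u s) := by
        refine lintegral_lintegral_swap ?_
        have hJ := (C.aemeasurable_jDensity hu.1).comp_snd (μ := volume.restrict (Ioi (0 : ℝ)))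
        have hmin : Measurable fun p : ℝ × ℝ => ENNReal.ofReal (min 1 (p.1 / p.2)) := by fun_prop
        exact (hD.comp measurable_fst).aemeasurable.mul (hmin.aemeasurable.mul hJ)
    _ ≤ _ := by
        refine setLIntegral_mono' measurableSet_Ioi fun s (hs : 0 < s) => ?_
        -- Writing min(1, t/s) = min(t,s)/s isolates the weight integral; its bound 2c·s·A(s)
        -- cancels the 1/s.
        have : ∀ t ∈ Ioi (0 : ℝ), ENNReal.ofReal (-deriv A t) *
            (ENNReal.ofReal (min 1 (t / s)) * C.jDensity u s) =
            (ENNReal.ofReal (-deriv A t) * ENNReal.ofReal (min t s)) *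
              (ENNReal.ofReal s⁻¹ * C.jDensity u s) := fun t ht => by
          have : min 1 (t / s) = min t s * s⁻¹ := by
            rw [min_mul_of_nonneg _ _ (inv_nonneg.2 hs.le), mul_inv_cancel₀ hs.ne', min_comm,
              div_eq_mul_inv]
          rw [this, ENNReal.ofReal_mul (le_min (le_of_lt ht) hs.le)]
          ring
        rw [setLIntegral_congr_fun measurableSet_Ioi this, lintegral_mul_const' _ _
          (ENNReal.mul_ne_top ENNReal.ofReal_ne_top (by simp [jDensity]))]
        calc _ ≤ ENNReal.ofReal (2 * c * (s * A s)) * (ENNReal.ofReal s⁻¹ * C.jDensity u s) := by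
              gcongr
              exact lintegral_neg_deriv_mul_min_le hA hac hpos hs fun r hr hrs => hc r s hr hrs
          _ = _ := by
              have := hpos s hs
              rw [← mul_assoc (ENNReal.ofReal _), ← mul_assoc (ENNReal.ofReal (2 * c)),
                ← ENNReal.ofReal_mul (by positivity), ← ENNReal.ofReal_mul (by positivity)]
              congr 2
              field_simp

end CompatibleCouple

/-! ### From series in X₀ ∩ X₁ to integral representations -/

theorem pairwise_disjoint_Ico_two_mul {t : ℤ → ℝ} (ht : ∀ k, 0 < t k)
    (h2 : ∀ k, 2 * t k ≤ t (k + 1)) :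
    Pairwise (Function.onFun Disjoint fun k => Ico (t k) (2 * t k)) := by
  have hmono : Monotone t := monotone_int_of_le_succ fun k => by linarith [ht k, h2 k]
  exact fun i j hij => (hmono.pairwise_disjoint_on_Ico_succ hij).mono
    (Ico_subset_Ico_right (h2 i)) (Ico_subset_Ico_right (h2 j))

namespace CompatibleCouple

variable {X₀ X₁ E : Type*}
  [NormedAddCommGroup X₀] [NormedSpace ℝ X₀]
  [NormedAddCommGroup X₁] [NormedSpace ℝ X₁]
  [AddCommGroup E] [Module ℝ E] [TopologicalSpace E] [IsTopologicalAddGroup E] [T2Space E]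
  (C : CompatibleCouple X₀ X₁ E)

/-- The step function that equals `(s / t k) • w k` for `s` in `[t k, 2 * t k)`. -/
noncomputable def stepFun (t : ℤ → ℝ) (w : ℤ → C.Inter) (s : ℝ) : C.Inter :=
  ∑' k, (Ico (t k) (2 * t k)).indicator (fun s => (s / t k) • w k) s

theorem stepFun_of_mem {t : ℤ → ℝ} (w : ℤ → C.Inter) (ht : ∀ k, 0 < t k)
    (h2 : ∀ k, 2 * t k ≤ t (k + 1)) {k : ℤ} {s : ℝ} (hs : s ∈ Ico (t k) (2 * t k)) :
    C.stepFun t w s = (s / t k) • w k := by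
  rw [stepFun, tsum_eq_single k, indicator_of_mem hs]
  exact fun j hj => indicator_of_notMem
    (fun hs' => (pairwise_disjoint_Ico_two_mul ht h2 hj).le_bot ⟨hs', hs⟩) _

theorem stepFun_of_notMem {t : ℤ → ℝ} (w : ℤ → C.Inter) {s : ℝ} (hs : s ∉ ⋃ k, Ico (t k) (2 * t k)) :
    C.stepFun t w s = 0 := by
  simp only [mem_iUnion, not_exists] at hs
  simp [stepFun, indicator_of_notMem (hs _)]

theorem aestronglyMeasurable_stepFun {t : ℤ → ℝ} (w : ℤ → C.Inter) (ht : ∀ k, 0 < t k)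
    (h2 : ∀ k, 2 * t k ≤ t (k + 1)) : AEStronglyMeasurable (C.stepFun t w) volume := by
  have hU : MeasurableSet (⋃ k, Ico (t k) (2 * t k)) := .iUnion fun _ => measurableSet_Ico
  have : (⋃ k, Ico (t k) (2 * t k)).indicator (C.stepFun t w) = C.stepFun t w :=
    indicator_eq_self.2 fun s hs => by_contra fun h => hs (C.stepFun_of_notMem w h)
  rw [← this, aestronglyMeasurable_indicator_iff hU, aestronglyMeasurable_iUnion_iff]
  intro k
  refine (Continuous.aestronglyMeasurable (by fun_prop : Continuous fun s : ℝ =>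
    (s / t k) • w k)).congr ?_
  refine (ae_restrict_iff' measurableSet_Ico).2 <| .of_forall fun s hs => ?_
  exact (C.stepFun_of_mem w ht h2 hs).symm

/-- On the window [t_k, 2t_k), of length t_k, the density is J(w_k,s)/t_k ≤ 2J(w_k,t_k)/t_k, and
v(s) ≤ v(t_k). -/
theorem lintegral_jDensity_stepFun_le {t : ℤ → ℝ} (w : ℤ → C.Inter) (ht : ∀ k, 0 < t k)
    (h2 : ∀ k, 2 * t k ≤ t (k + 1)) {v : ℝ → ℝ} (hv₀ : ∀ s, 0 < s → 0 ≤ v s)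
    (hv : AntitoneOn v (Ioi 0)) :
    ∫⁻ s in Ioi 0, ENNReal.ofReal (v s) * C.jDensity (C.stepFun t w) s ≤
      2 * ∑' k, ENNReal.ofReal (v (t k) * C.jFun (w k) (t k)) := by
  have hU : MeasurableSet (⋃ k, Ico (t k) (2 * t k)) := .iUnion fun _ => measurableSet_Ico
  have hle : ∀ s, ENNReal.ofReal (v s) * C.jDensity (C.stepFun t w) s ≤
      (⋃ k, Ico (t k) (2 * t k)).indicator
        (fun s => ENNReal.ofReal (v s) * C.jDensity (C.stepFun t w) s) s := fun s => by
    by_cases hs : s ∈ ⋃ k, Ico (t k) (2 * t k)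
    · rw [indicator_of_mem hs]
    · have h0 : C.jFun 0 s = 0 := by simp [jFun]
      rw [indicator_of_notMem hs, jDensity, C.stepFun_of_notMem w hs, h0]
      simp
  calc ∫⁻ s in Ioi 0, ENNReal.ofReal (v s) * C.jDensity (C.stepFun t w) s
      ≤ ∫⁻ s, (⋃ k, Ico (t k) (2 * t k)).indicator
          (fun s => ENNReal.ofReal (v s) * C.jDensity (C.stepFun t w) s) s :=
        (setLIntegral_le_lintegral _ _).trans (lintegral_mono hle)
    _ = ∑' k, ∫⁻ s in Ico (t k) (2 * t k),
          ENNReal.ofReal (v s) * C.jDensity (C.stepFun t w) s := by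
        rw [lintegral_indicator hU, lintegral_iUnion (fun _ => measurableSet_Ico)
          (pairwise_disjoint_Ico_two_mul ht h2)]
    _ ≤ ∑' k, 2 * ENNReal.ofReal (v (t k) * C.jFun (w k) (t k)) := by
        refine ENNReal.tsum_le_tsum fun k => ?_
        have hk := ht k
        have hJ := C.jFun_nonneg (w k) (t k)
        have hvk := hv₀ _ hk
        calc ∫⁻ s in Ico (t k) (2 * t k), ENNReal.ofReal (v s) * C.jDensity (C.stepFun t w) s
            ≤ ∫⁻ s in Ico (t k) (2 * t k),
                ENNReal.ofReal (v (t k) * ((t k)⁻¹ * (2 * C.jFun (w k) (t k)))) := by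
              refine setLIntegral_mono' measurableSet_Ico fun s hs => ?_
              have hs0 : 0 < s := hk.trans_le hs.1
              rw [jDensity, C.stepFun_of_mem w ht h2 hs, jFun_smul,
                abs_of_nonneg (by positivity), ← ENNReal.ofReal_mul (hv₀ s hs0)]
              refine ENNReal.ofReal_le_ofReal ?_
              have h1 : s⁻¹ * (s / t k * C.jFun (w k) s) = (t k)⁻¹ * C.jFun (w k) s := by
                field_simp
              rw [h1]
              have h3 := C.jFun_nonneg (w k) s
              have h4 := C.jFun_le_two_mul (w k) hs.2.le
              have h5 := hv hk hs0 hs.1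
              gcongr
          _ = 2 * ENNReal.ofReal (v (t k) * C.jFun (w k) (t k)) := by
              rw [lintegral_const, Measure.restrict_apply_univ, Real.volume_Ico,
                ← ENNReal.ofReal_mul (by positivity), ← ENNReal.ofReal_ofNat 2,
                ← ENNReal.ofReal_mul (by positivity)]
              congr 1
              field_simp
              ring
    _ = _ := ENNReal.tsum_mul_left

/-- A weight that is at least a multiple of min(1, 1/s) dominates the norm of X₀ + X₁, so Bochner
convergence comes for free. -/
theorem integrableOn_of_lintegral_jDensity_ne_top {v : ℝ → ℝ} {m : ℝ} (hm : 0 < m)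
    (hv : ∀ s, 0 < s → m * min 1 s⁻¹ ≤ v s) {u : ℝ → C.Inter}
    (hu : AEStronglyMeasurable u (volume.restrict (Ioi 0)))
    (hfin : ∫⁻ s in Ioi 0, ENNReal.ofReal (v s) * C.jDensity u s ≠ ∞) :
    IntegrableOn (fun s : ℝ => s⁻¹ • C.interToSum (u s)) (Ioi 0) := by
  refine ⟨(measurable_inv.aestronglyMeasurable (f := fun s : ℝ => s⁻¹)).smul
    (C.continuous_interToSum.comp_aestronglyMeasurable hu), ?_⟩
  refine lt_of_le_of_lt (?_ : _ ≤ ENNReal.ofReal m⁻¹ *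
    ∫⁻ s in Ioi 0, ENNReal.ofReal (v s) * C.jDensity u s)
    (ENNReal.mul_lt_top ENNReal.ofReal_lt_top hfin.lt_top)
  rw [← lintegral_const_mul' _ _ ENNReal.ofReal_ne_top]
  refine setLIntegral_mono' measurableSet_Ioi fun s (hs : 0 < s) => ?_
  have hJ := C.jFun_nonneg (u s) s
  have hmin : 0 ≤ min 1 s⁻¹ := by positivity
  have hvs : 0 ≤ v s := (mul_nonneg hm.le hmin).trans (hv s hs)
  rw [jDensity, ← ENNReal.ofReal_mul hvs, ← ENNReal.ofReal_mul (by positivity), ← ofReal_norm,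
    norm_smul, norm_inv, Real.norm_of_nonneg hs.le]
  refine ENNReal.ofReal_le_ofReal ?_
  have h := hv s hs
  calc s⁻¹ * ‖C.interToSum (u s)‖ ≤ s⁻¹ * (min 1 s⁻¹ * C.jFun (u s) s) := by
        gcongr; exact C.norm_interToSum_le _ hs
    _ = m⁻¹ * ((m * min 1 s⁻¹) * (s⁻¹ * C.jFun (u s) s)) := by field_simp
    _ ≤ m⁻¹ * (v s * (s⁻¹ * C.jFun (u s) s)) := by gcongr

theorem summable_interToSum_of_tsum_jFun_ne_top [CompleteSpace X₀] [CompleteSpace X₁]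
    {v : ℝ → ℝ} {m : ℝ} (hm : 0 < m)
    (hv : ∀ s, 0 < s → m * min 1 s⁻¹ ≤ v s) {t : ℤ → ℝ} (ht : ∀ k, 0 < t k) {w : ℤ → C.Inter}
    (hfin : ∑' k, ENNReal.ofReal (v (t k) * C.jFun (w k) (t k)) ≠ ∞) :
    Summable fun k => C.interToSum (w k) := by
  have hmin : ∀ k, 0 ≤ min 1 (t k)⁻¹ := fun k => by have := ht k; positivity
  have hvk : ∀ k, 0 ≤ v (t k) := fun k => (mul_nonneg hm.le (hmin k)).trans (hv _ (ht k))
  have hs : Summable fun k => v (t k) * C.jFun (w k) (t k) := by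
    refine (ENNReal.summable_toReal hfin).congr fun k => ?_
    exact ENNReal.toReal_ofReal (mul_nonneg (hvk k) (C.jFun_nonneg _ _))
  refine Summable.of_norm_bounded (hs.mul_left m⁻¹) fun k => ?_
  have hJ := C.jFun_nonneg (w k) (t k)
  have h := hv _ (ht k)
  calc ‖C.interToSum (w k)‖ ≤ min 1 (t k)⁻¹ * C.jFun (w k) (t k) :=
        C.norm_interToSum_le _ (ht k)
    _ = m⁻¹ * ((m * min 1 (t k)⁻¹) * C.jFun (w k) (t k)) := by field_simp
    _ ≤ m⁻¹ * (v (t k) * C.jFun (w k) (t k)) := by gcongr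

theorem jNorm_le_two_mul_tsum [CompleteSpace X₀] [CompleteSpace X₁] {v : ℝ → ℝ} (hva : AntitoneOn v (Ioi 0)) {m : ℝ} (hm : 0 < m)
    (hv : ∀ s, 0 < s → m * min 1 s⁻¹ ≤ v s) {t : ℤ → ℝ} (ht : ∀ k, 0 < t k)
    (h2 : ∀ k, 2 * t k ≤ t (k + 1)) {w : ℤ → C.Inter} {f : C.Sum}
    (hfin : ∑' k, ENNReal.ofReal (v (t k) * C.jFun (w k) (t k)) ≠ ∞)
    (hsum : HasSum (fun k => C.interToSum (w k)) f) :
    C.jNorm 0 1 v f ≤ 2 * ∑' k, ENNReal.ofReal (v (t k) * C.jFun (w k) (t k)) := by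
  have hv₀ : ∀ s, 0 < s → 0 ≤ v s := fun s hs => le_trans (by positivity) (hv s hs)
  have hle := C.lintegral_jDensity_stepFun_le w ht h2 hv₀ hva
  have hmeas : AEStronglyMeasurable (C.stepFun t w) (volume.restrict (Ioi 0)) :=
    (C.aestronglyMeasurable_stepFun w ht h2).restrict
  have hint := C.integrableOn_of_lintegral_jDensity_ne_top hm hv hmeas
    (ne_top_of_le_ne_top (ENNReal.mul_ne_top (by simp) hfin) hle)
  have hsub : (⋃ k, Ico (t k) (2 * t k)) ⊆ Ioi (0 : ℝ) :=
    iUnion_subset fun k s hs => (ht k).trans_le hs.1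
  refine (C.jNorm_le_lintegral hv₀ ⟨hmeas, hint, ?_⟩).trans hle
  have hzero : C.interToSum (0 : C.Inter) = 0 := C.incl₀.map_zero
  rw [setIntegral_eq_of_subset_of_forall_sdiff_eq_zero measurableSet_Ioi hsub fun s hs => by
    rw [C.stepFun_of_notMem w hs.2, hzero, smul_zero]]
  -- The factor s/t_k in the step function cancels the 1/s of the measure: the integrand is constant
  -- on a window of length t_k.
  have hint_eq : ∀ k, ∫ s in Ico (t k) (2 * t k), s⁻¹ • C.interToSum (C.stepFun t w s) =
      C.interToSum (w k) := fun k => by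
    have hk := ht k
    have hc : EqOn (fun s : ℝ => s⁻¹ • C.interToSum (C.stepFun t w s))
        (fun _ => (t k)⁻¹ • C.interToSum (w k)) (Ico (t k) (2 * t k)) := fun s hs => by
      have hs0 : s ≠ 0 := (hk.trans_le hs.1).ne'
      simp only [C.stepFun_of_mem w ht h2 hs, interToSum_smul, smul_smul]
      congr 1
      field_simp
    rw [setIntegral_congr_fun measurableSet_Ico hc, setIntegral_const, smul_smul, Measure.real,
      Real.volume_Ico, ENNReal.toReal_ofReal (by linarith)]
    have h1 : (2 * t k - t k) * (t k)⁻¹ = 1 := by field_simp; norm_num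
    rw [h1, one_smul]
  have h := hasSum_integral_iUnion (fun _ => measurableSet_Ico)
    (pairwise_disjoint_Ico_two_mul ht h2) (hint.mono_set hsub)
  simp only [hint_eq] at h
  exact h.unique hsum

/-- The difference `x' - x = y - y'` of two decompositions `x + y = x' + y'`. -/
noncomputable def diffInter {x x' : X₀} {y y' : X₁} (h : C.add x y = C.add x' y') : C.Inter :=
  ⟨(x' - x, y - y'), by
    have h' := (C.add_eq_add_iff _ _ _ _).1 h
    simp only [LinearMap.mem_eqLocus, ContinuousLinearMap.coe_coe, ContinuousLinearMap.comp_apply,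
      ContinuousLinearMap.coe_fst', ContinuousLinearMap.coe_snd', map_sub]
    rw [sub_eq_sub_iff_add_eq_add, ← h', add_comm]⟩

/-- Summability being given, the two half-series may be summed separately by telescoping: k ≥ 0
gives f - x_0, as x_n = f - y_n → f, and k < 0 gives x_0. -/
theorem hasSum_diffInter [CompleteSpace X₀] [CompleteSpace X₁] {f : C.Sum} {x : ℤ → X₀} {y : ℤ → X₁} (h : ∀ k, C.add (x k) (y k) = f)
    (hx : Tendsto (fun n : ℕ => x (-n)) atTop (𝓝 0)) (hy : Tendsto (fun n : ℕ => y n) atTop (𝓝 0))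
    (hs : Summable fun k => C.interToSum (C.diffInter ((h k).trans (h (k + 1)).symm))) :
    HasSum (fun k => C.interToSum (C.diffInter ((h k).trans (h (k + 1)).symm))) f := by
  have hd : ∀ k, C.interToSum (C.diffInter ((h k).trans (h (k + 1)).symm)) =
      C.incl₀ (x (k + 1)) - C.incl₀ (x k) := fun k => by
    rw [interToSum_eq_incl₀, ← map_sub]
    rfl
  have hx' : Tendsto (fun n : ℕ => C.incl₀ (x (-n))) atTop (𝓝 0) := by
    simpa [Function.comp_def] using (C.incl₀.continuous.tendsto 0).comp hx
  have hy' : Tendsto (fun n : ℕ => C.incl₁ (y n)) atTop (𝓝 0) := by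
    simpa [Function.comp_def] using (C.incl₁.continuous.tendsto 0).comp hy
  simp only [hd] at hs ⊢
  have hpos : HasSum (fun n : ℕ => C.incl₀ (x ((n : ℤ) + 1)) - C.incl₀ (x n))
      (f - C.incl₀ (x 0)) := by
    have hsn : Summable (fun n : ℕ => C.incl₀ (x ((n : ℤ) + 1)) - C.incl₀ (x n)) :=
      hs.comp_injective Nat.cast_injective
    refine (hsn.hasSum_iff_tendsto_nat).2 ?_
    have : ∀ n : ℕ, ∑ i ∈ Finset.range n, (C.incl₀ (x ((i : ℤ) + 1)) - C.incl₀ (x i)) =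
        f - C.incl₁ (y n) - C.incl₀ (x 0) := fun n => by
      have h1 := Finset.sum_range_sub (fun i : ℕ => C.incl₀ (x i)) n
      push_cast at h1
      rw [h1, ← h n, add_eq_incl, add_sub_cancel_right]
    simp only [this]
    simpa using (tendsto_const_nhds.sub hy').sub_const (C.incl₀ (x 0))
  have hneg : HasSum (fun n : ℕ => C.incl₀ (x (-((n : ℤ) + 1) + 1)) - C.incl₀ (x (-((n : ℤ) + 1))))
      (C.incl₀ (x 0)) := by
    have hsn : Summable
        (fun n : ℕ => C.incl₀ (x (-((n : ℤ) + 1) + 1)) - C.incl₀ (x (-((n : ℤ) + 1)))) :=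
      hs.comp_injective (i := fun n : ℕ => -((n : ℤ) + 1)) fun m n hmn => by
        simpa using hmn
    refine (hsn.hasSum_iff_tendsto_nat).2 ?_
    have : ∀ n : ℕ, ∑ i ∈ Finset.range n,
        (C.incl₀ (x (-((i : ℤ) + 1) + 1)) - C.incl₀ (x (-((i : ℤ) + 1)))) =
        C.incl₀ (x 0) - C.incl₀ (x (-n)) := fun n => by
      have h1 := Finset.sum_range_sub' (fun i : ℕ => C.incl₀ (x (-i))) n
      simpa using h1
    simp only [this]
    simpa using tendsto_const_nhds.sub hx'
  simpa using HasSum.of_nat_of_neg_add_one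
    (f := fun k : ℤ => C.incl₀ (x (k + 1)) - C.incl₀ (x k)) hpos hneg

theorem jNorm_le_two_mul_tsum_diffInter [CompleteSpace X₀] [CompleteSpace X₁]
    {v : ℝ → ℝ} (hva : AntitoneOn v (Ioi 0)) {m : ℝ} (hm : 0 < m)
    (hv : ∀ s, 0 < s → m * min 1 s⁻¹ ≤ v s) {t : ℤ → ℝ} (ht : ∀ k, 0 < t k)
    (h2 : ∀ k, 2 * t k ≤ t (k + 1)) {f : C.Sum} {x : ℤ → X₀} {y : ℤ → X₁}
    (h : ∀ k, C.add (x k) (y k) = f) (hx : Tendsto (fun n : ℕ => x (-n)) atTop (𝓝 0))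
    (hy : Tendsto (fun n : ℕ => y n) atTop (𝓝 0)) :
    C.jNorm 0 1 v f ≤ 2 * ∑' k, ENNReal.ofReal
      (v (t k) * max ‖x (k + 1) - x k‖ (t k * ‖y k - y (k + 1)‖)) := by
  by_cases hfin : ∑' k, ENNReal.ofReal
      (v (t k) * max ‖x (k + 1) - x k‖ (t k * ‖y k - y (k + 1)‖)) = ∞
  · simp [hfin]
  exact C.jNorm_le_two_mul_tsum (w := fun k => C.diffInter ((h k).trans (h (k + 1)).symm))
    hva hm hv ht h2 hfin
    (C.hasSum_diffInter h hx hy (C.summable_interToSum_of_tsum_jFun_ne_top hm hv ht hfin))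

end CompatibleCouple

/-! ### Geometric levels of the weight -/

section Levels

theorem one_le_of_sqrt_mul_le {A : ℝ → ℝ} (hpos : ∀ s, 0 < s → 0 < A s) {c : ℝ}
    (hc : ∀ r s, 0 < r → r ≤ s → √r * A r ≤ c * (√s * A s)) : 1 ≤ c := by
  have h := hc 1 1 one_pos le_rfl
  have h1 := hpos 1 one_pos
  rw [Real.sqrt_one, one_mul] at h
  exact (le_mul_iff_one_le_left h1).1 h

/-- By continuity A takes every value A(1)(2c)^(-k). The ratio 2c is chosen because A(t) ≤ c√2·A(2t)
≤ 2c·A(2t): a drop by this factor needs at least a doubling of t. -/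
theorem exists_geometric_levels {A : ℝ → ℝ} (hA : StrictAntiOn A (Ioi 0))
    (hcont : ContinuousOn A (Ioi 0)) (hpos : ∀ s, 0 < s → 0 < A s)
    (h0 : Tendsto A (𝓝[>] 0) atTop) (htop : Tendsto A atTop (𝓝 0)) {c : ℝ}
    (hc : ∀ r s, 0 < r → r ≤ s → √r * A r ≤ c * (√s * A s)) :
    ∃ t : ℤ → ℝ, (∀ k, 0 < t k) ∧ t 0 = 1 ∧ (∀ k, A (t k) = 2 * c * A (t (k + 1))) ∧
      ∀ k, 2 * t k ≤ t (k + 1) := by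
  have hc1 := one_le_of_sqrt_mul_le hpos hc
  have hM : (0 : ℝ) < 2 * c := by linarith
  have hsurj : ∀ z, 0 < z → ∃ s, 0 < s ∧ A s = z := fun z hz => by
    obtain ⟨r, hr, hr0⟩ := ((h0.eventually_ge_atTop z).and self_mem_nhdsWithin).exists
    obtain ⟨s, hs, hs0⟩ := ((htop.eventually_le_const hz).and (eventually_gt_atTop 0)).exists
    obtain ⟨q, hq, rfl⟩ := hcont.surjOn_Icc hs0 hr0 ⟨hs, hr⟩
    exact ⟨q, hq, rfl⟩
  have hA1 := hpos 1 one_pos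
  choose t ht htA using fun k : ℤ => hsurj (A 1 * (2 * c) ^ (-k)) (by positivity)
  have hstep : ∀ k, A (t k) = 2 * c * A (t (k + 1)) := fun k => by
    rw [htA, htA, neg_add, zpow_add₀ hM.ne', zpow_neg_one]
    field_simp
  refine ⟨t, ht, hA.injOn (ht 0) (mem_Ioi.2 one_pos) (by simp [htA]), hstep, fun k => ?_⟩
  by_contra! hlt
  have hk := ht k
  have h2k : 0 < 2 * t k := by linarith
  have h1 := hA (ht (k + 1)) (mem_Ioi.2 h2k) hlt
  have h2 := hc (t k) (2 * t k) hk (by linarith)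
  have h3 : √(2 * t k) ≤ 2 * √(t k) := by
    rw [Real.sqrt_le_left (by positivity), mul_pow, Real.sq_sqrt hk.le]
    linarith
  have h4 : √(t k) * A (t k) ≤ √(t k) * (2 * c * A (2 * t k)) :=
    calc √(t k) * A (t k) ≤ c * (√(2 * t k) * A (2 * t k)) := h2
      _ ≤ c * (2 * √(t k) * A (2 * t k)) := by have := hpos _ h2k; gcongr
      _ = _ := by ring
  have h5 := le_of_mul_le_mul_left h4 (Real.sqrt_pos.2 hk)
  rw [hstep k] at h5
  exact absurd (le_of_mul_le_mul_left h5 hM) (not_le.2 h1)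

theorem mul_min_le_of_sqrt_mul_le {A : ℝ → ℝ} (hA : AntitoneOn A (Ioi 0))
    (hpos : ∀ s, 0 < s → 0 < A s) {c : ℝ}
    (hc : ∀ r s, 0 < r → r ≤ s → √r * A r ≤ c * (√s * A s)) {s : ℝ} (hs : 0 < s) :
    A 1 / c * min 1 s⁻¹ ≤ A s := by
  have hc1 := one_le_of_sqrt_mul_le hpos hc
  have hc0 : 0 < c := by linarith
  have hA1 := hpos 1 one_pos
  have hAs := hpos s hs
  rcases le_total s 1 with h | h
  · calc A 1 / c * min 1 s⁻¹ ≤ A 1 * 1 := by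
          gcongr
          · exact div_le_self hA1.le hc1
          · exact min_le_left _ _
      _ ≤ A s := by rw [mul_one]; exact hA hs (mem_Ioi.2 one_pos) h
  · have h1 := hc 1 s one_pos h
    have hsq : √s ≤ s := (Real.sqrt_le_left hs.le).2 (by nlinarith)
    rw [Real.sqrt_one, one_mul] at h1
    calc A 1 / c * min 1 s⁻¹ ≤ A 1 / c * s⁻¹ := by gcongr; exact min_le_right _ _
      _ ≤ A s := by
        rw [← div_eq_mul_inv, div_div, div_le_iff₀ (by positivity)]
        calc A 1 ≤ c * (√s * A s) := h1
          _ ≤ c * (s * A s) := by gcongr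
          _ = A s * (c * s) := by ring

theorem tendsto_atTop_of_two_mul_le {t : ℤ → ℝ} (ht : ∀ k, 0 < t k)
    (h2 : ∀ k, 2 * t k ≤ t (k + 1)) : Tendsto (fun n : ℕ => t n) atTop atTop := by
  have hle : ∀ n : ℕ, t 0 * 2 ^ n ≤ t n := fun n => by
    induction n with
    | zero => simp
    | succ n ih =>
      have := h2 n
      push_cast
      rw [pow_succ]
      linarith
  exact tendsto_atTop_mono hle
    ((tendsto_pow_atTop_atTop_of_one_lt one_lt_two).const_mul_atTop (ht 0))

end Levels

/-! ### The J-norm is bounded by the K-norm on X₀ -/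

namespace CompatibleCouple

variable {X₀ X₁ E : Type*}
  [NormedAddCommGroup X₀] [NormedSpace ℝ X₀]
  [NormedAddCommGroup X₁] [NormedSpace ℝ X₁]
  [AddCommGroup E] [Module ℝ E] [TopologicalSpace E] [IsTopologicalAddGroup E] [T2Space E]
  (C : CompatibleCouple X₀ X₁ E)

/-- On (t_k, t_{k+1}] one has K(f,s) ≥ K(f,t_k), while -A' integrates to A(t_k) - A(t_{k+1}) ≥
A(t_k)/2 since M ≥ 2. -/
theorem tsum_mul_kFun_le {A : ℝ → ℝ} (hA : AntitoneOn A (Ioi 0))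
    (hac : LocallyAbsolutelyContinuous A) (hpos : ∀ s, 0 < s → 0 < A s) {t : ℤ → ℝ}
    (ht : ∀ k, 0 < t k) (htm : Monotone t) {M : ℝ} (hM : 2 ≤ M)
    (hAt : ∀ k, A (t k) = M * A (t (k + 1))) (f : C.Sum) :
    ∑' k, ENNReal.ofReal (A (t k) * C.kFun f (t k)) ≤
      2 * ∫⁻ s in Ioi 0, ENNReal.ofReal (-deriv A s) * ENNReal.ofReal (C.kFun f s) := by
  have hsub : (⋃ k, Ioc (t k) (t (k + 1))) ⊆ Ioi (0 : ℝ) :=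
    iUnion_subset fun k s hs => (ht k).trans hs.1
  have hdisj : Pairwise (Function.onFun Disjoint fun k => Ioc (t k) (t (k + 1))) :=
    htm.pairwise_disjoint_on_Ioc_succ
  refine le_trans ?_ (mul_le_mul_right (lintegral_mono_set hsub) 2)
  rw [lintegral_iUnion (fun _ => measurableSet_Ioc) hdisj,
    ← ENNReal.tsum_mul_left]
  refine ENNReal.tsum_le_tsum fun k => ?_
  have hk := ht k
  have hK := C.kFun_nonneg f hk.le
  have hA1 := hpos _ (ht (k + 1))
  calc ENNReal.ofReal (A (t k) * C.kFun f (t k))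
      ≤ ENNReal.ofReal (2 * ((A (t k) - A (t (k + 1))) * C.kFun f (t k))) := by
        refine ENNReal.ofReal_le_ofReal ?_
        rw [← mul_assoc]
        gcongr
        nlinarith [hAt k]
    _ = 2 * (ENNReal.ofReal (A (t k) - A (t (k + 1))) * ENNReal.ofReal (C.kFun f (t k))) := by
        rw [ENNReal.ofReal_mul two_pos.le, ENNReal.ofReal_mul' hK, ENNReal.ofReal_ofNat]
    _ ≤ _ := by
        rw [← setLIntegral_Ioc_neg_deriv hA hac hk (htm (by lia)),
          ← lintegral_mul_const' _ _ ENNReal.ofReal_ne_top]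
        gcongr 2 * ?_
        refine setLIntegral_mono' measurableSet_Ioc fun s hs => ?_
        gcongr
        exact C.kFun_mono f hk.le hs.1.le

theorem max_norm_sub_le_four_mul_kFun {f : C.Sum} {s t : ℝ} (hs : 0 < s) (hst : s ≤ t)
    {x x' : X₀} {y y' : X₁} (h : ‖x‖ + s * ‖y‖ ≤ 2 * C.kFun f s)
    (h' : ‖x'‖ + t * ‖y'‖ ≤ 2 * C.kFun f t) :
    max ‖x' - x‖ (s * ‖y - y'‖) ≤ 4 * C.kFun f t := by
  have hK := C.kFun_mono f hs.le hst
  have hx := norm_sub_le x' x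
  have hy := norm_sub_le y y'
  have h1 : s * ‖y'‖ ≤ t * ‖y'‖ := by gcongr
  have h2 : 0 ≤ s * ‖y‖ := by positivity
  have h3 : 0 ≤ s * ‖y'‖ := by positivity
  have h4 := norm_nonneg x
  have h5 := norm_nonneg x'
  refine max_le (by linarith) ?_
  have h6 : s * ‖y - y'‖ ≤ s * (‖y‖ + ‖y'‖) := by gcongr
  linarith

/-- The terms of a convergent series tend to 0, and A(t_k) stays away from 0 for k ≤ 0. -/
theorem tendsto_of_tsum_mul_kFun_ne_top {A : ℝ → ℝ} {m : ℝ} (hm : 0 < m) {t : ℤ → ℝ}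
    (ht : ∀ k, 0 < t k) (hA : ∀ k ≤ 0, m ≤ A (t k)) {f : C.Sum}
    (hfin : ∑' k, ENNReal.ofReal (A (t k) * C.kFun f (t k)) ≠ ∞) {x : ℤ → X₀}
    (hx : ∀ k ≤ 0, ‖x k‖ ≤ 2 * C.kFun f (t k)) :
    Tendsto (fun n : ℕ => x (-n)) atTop (𝓝 0) := by
  have h1 : Tendsto (fun n : ℕ => 2 / m *
      (ENNReal.ofReal (A (t (-n)) * C.kFun f (t (-n)))).toReal) atTop (𝓝 (2 / m * 0)) := by
    have hs := (ENNReal.summable_toReal hfin).comp_injective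
      (i := fun n : ℕ => -(n : ℤ)) (neg_injective.comp Nat.cast_injective)
    exact hs.tendsto_atTop_zero.const_mul _
  rw [mul_zero] at h1
  refine squeeze_zero_norm (fun n => ?_) h1
  have hn : -(n : ℤ) ≤ 0 := by lia
  have hK := C.kFun_nonneg f (ht (-n)).le
  have hAn := hA _ hn
  rw [ENNReal.toReal_ofReal (mul_nonneg (hm.le.trans hAn) hK)]
  calc ‖x (-n)‖ ≤ 2 * C.kFun f (t (-n)) := hx _ hn
    _ = 2 / m * (m * C.kFun f (t (-n))) := by field_simp
    _ ≤ _ := by gcongr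

theorem tsum_ofReal_mul_succ {g : ℤ → ℝ} {r : ℝ} (hr : 0 ≤ r) :
    ∑' k, ENNReal.ofReal (r * g (k + 1)) = ENNReal.ofReal r * ∑' k, ENNReal.ofReal (g k) := by
  simp only [ENNReal.ofReal_mul hr]
  rw [ENNReal.tsum_mul_left, ← (Equiv.addRight (1 : ℤ)).tsum_eq fun k => ENNReal.ofReal (g k)]
  rfl

section Decomposition

variable [CompleteSpace X₀] [CompleteSpace X₁]

/-- The constant is 2 (step function) · 4 (differences) · 2c (from A(t_k) to A(t_{k+1})) · 2
(discretisation). -/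
theorem jNorm_incl₀_le_mul_kNorm {A B : ℝ → ℝ} (hA : StrictAntiOn A (Ioi 0))
    (hac : LocallyAbsolutelyContinuous A) (hcont : ContinuousOn A (Ioi 0))
    (hpos : ∀ s, 0 < s → 0 < A s)
    (h0 : Tendsto A (𝓝[>] 0) atTop) (htop : Tendsto A atTop (𝓝 0)) {c : ℝ}
    (hc : ∀ r s, 0 < r → r ≤ s → √r * A r ≤ c * (√s * A s))
    (hB : ∀ᵐ x ∂(volume.restrict (Ioi (0 : ℝ))), B x = -(x * deriv A x)) (z : X₀) :
    C.jNorm 0 1 A (C.incl₀ z) ≤ ENNReal.ofReal (32 * c) * C.kNorm 0 1 B (C.incl₀ z) := by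
  obtain ⟨t, ht, ht0, hAt, h2⟩ := exists_geometric_levels hA hcont hpos h0 htop hc
  have hc1 := one_le_of_sqrt_mul_le hpos hc
  have hc0 : 0 < c := by linarith
  have htm : Monotone t := monotone_int_of_le_succ fun k => by linarith [ht k, h2 k]
  set f := C.incl₀ z with hf
  have hS := C.tsum_mul_kFun_le hA.antitoneOn hac hpos ht htm (by linarith) hAt f
  rw [← C.kNorm_eq_lintegral_neg_deriv hA.antitoneOn hB] at hS
  by_cases hfin : C.kNorm 0 1 B f = ∞
  · rw [hfin, ENNReal.mul_top (by simpa using hc0)]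
    exact le_top
  choose x y hxy hle using fun k => C.exists_norm_le_two_mul_kFun f (ht k)
  -- This is where f ∈ X₀ is used: t_n‖y_n‖ ≤ 2K(f,t_n) ≤ 2‖z‖ and t_n → ∞.
  have hy : Tendsto (fun n : ℕ => y n) atTop (𝓝 0) := by
    have h1 : Tendsto (fun n : ℕ => 2 * ‖z‖ / t n) atTop (𝓝 0) :=
      (tendsto_atTop_of_two_mul_le ht h2).const_div_atTop _
    refine squeeze_zero_norm (fun n => ?_) h1
    rw [le_div_iff₀' (ht n)]
    linarith [hle n, norm_nonneg (x n), C.kFun_incl₀_le z (ht n).le]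
  have hx : Tendsto (fun n : ℕ => x (-n)) atTop (𝓝 0) :=
    C.tendsto_of_tsum_mul_kFun_ne_top (hpos 1 one_pos) ht
      (fun k hk => hA.antitoneOn (ht k) (mem_Ioi.2 one_pos) (ht0 ▸ htm hk))
      (ne_top_of_le_ne_top (ENNReal.mul_ne_top (by simp) hfin) hS)
      fun k _ => by have := ht k; nlinarith [hle k, norm_nonneg (y k)]
  calc C.jNorm 0 1 A f ≤ _ := C.jNorm_le_two_mul_tsum_diffInter hA.antitoneOn
        (div_pos (hpos 1 one_pos) hc0)
        (fun s hs => mul_min_le_of_sqrt_mul_le hA.antitoneOn hpos hc hs) ht h2 hxy hx hy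
    _ ≤ 2 * ∑' k, ENNReal.ofReal (8 * c * (A (t (k + 1)) * C.kFun f (t (k + 1)))) := by
        refine mul_le_mul_right (ENNReal.tsum_le_tsum fun k => ENNReal.ofReal_le_ofReal ?_) 2
        have h1 := C.max_norm_sub_le_four_mul_kFun (ht k) (htm (by lia)) (hle k) (hle (k + 1))
        have h3 := hpos _ (ht k)
        calc _ ≤ A (t k) * (4 * C.kFun f (t (k + 1))) := by gcongr
          _ = _ := by rw [hAt k]; ring
    _ ≤ 2 * (ENNReal.ofReal (8 * c) * (2 * C.kNorm 0 1 B f)) := by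
        rw [tsum_ofReal_mul_succ (g := fun k => A (t k) * C.kFun f (t k)) (by positivity)]
        gcongr
    _ = _ := by
        have : 32 * c = 2 * (8 * c) * 2 := by ring
        rw [this, ENNReal.ofReal_mul' two_pos.le, ENNReal.ofReal_mul two_pos.le,
          ENNReal.ofReal_ofNat]
        ring

theorem jNorm_incl₀_le_add {A B a : ℝ → ℝ} (hA : StrictAntiOn A (Ioi 0))
    (hac : LocallyAbsolutelyContinuous A) (hcont : ContinuousOn A (Ioi 0))
    (hpos : ∀ s, 0 < s → 0 < A s)
    (h0 : Tendsto A (𝓝[>] 0) atTop) (htop : Tendsto A atTop (𝓝 0)) {c : ℝ}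
    (hc : ∀ r s, 0 < r → r ≤ s → √r * A r ≤ c * (√s * A s))
    (hB : ∀ᵐ x ∂(volume.restrict (Ioi (0 : ℝ))), B x = -(x * deriv A x))
    (ha : AntitoneOn a (Ioi 0)) {l : ℝ} (hl : 0 < l) (hal : ∀ s, 0 < s → l ≤ a s)
    (haA : ∀ s, 0 < s → s ≤ 1 → A s = a s) (z : X₀) :
    C.jNorm 0 1 a (C.incl₀ z) ≤
      ENNReal.ofReal (32 * c) * C.kNorm 0 1 B (C.incl₀ z) + ENNReal.ofReal (6 * a 1) * ‖z‖ₑ := by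
  obtain ⟨t, ht, ht0, hAt, h2⟩ := exists_geometric_levels hA hcont hpos h0 htop hc
  have hc1 := one_le_of_sqrt_mul_le hpos hc
  have hc0 : 0 < c := by linarith
  have htm : Monotone t := monotone_int_of_le_succ fun k => by linarith [ht k, h2 k]
  set f := C.incl₀ z with hf
  have hS := C.tsum_mul_kFun_le hA.antitoneOn hac hpos ht htm (by linarith) hAt f
  rw [← C.kNorm_eq_lintegral_neg_deriv hA.antitoneOn hB] at hS
  by_cases hfin : C.kNorm 0 1 B f = ∞
  · rw [hfin, ENNReal.mul_top (by simpa using hc0), top_add]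
    exact le_top
  choose x y hxy hle using fun k => C.exists_norm_le_two_mul_kFun f (ht k)
  -- Beyond level 1 the weight a is not controlled by A, so the trivial splitting f = z + 0 is used
  -- there and all later differences vanish.
  set x' : ℤ → X₀ := fun k => if k ≤ 0 then x k else z with hx'
  set y' : ℤ → X₁ := fun k => if k ≤ 0 then y k else 0 with hy'
  have hxy' : ∀ k, C.add (x' k) (y' k) = f := fun k => by
    by_cases hk : k ≤ 0
    · simp only [hx', hy', if_pos hk, hxy]
    · simp only [hx', hy', if_neg hk]
      rfl
  have hy : Tendsto (fun n : ℕ => y' n) atTop (𝓝 0) := by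
    refine tendsto_const_nhds.congr' ?_
    filter_upwards [eventually_gt_atTop 0] with n hn
    exact (if_neg (by lia)).symm
  have hx : Tendsto (fun n : ℕ => x' (-n)) atTop (𝓝 0) :=
    C.tendsto_of_tsum_mul_kFun_ne_top (hpos 1 one_pos) ht
      (fun k hk => hA.antitoneOn (ht k) (mem_Ioi.2 one_pos) (ht0 ▸ htm hk))
      (ne_top_of_le_ne_top (ENNReal.mul_ne_top (by simp) hfin) hS)
      fun k hk => by
        simp only [hx', if_pos hk]
        have := ht k
        nlinarith [hle k, norm_nonneg (y k)]
  have hterm : ∀ k, ENNReal.ofReal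
      (a (t k) * max ‖x' (k + 1) - x' k‖ (t k * ‖y' k - y' (k + 1)‖)) ≤
      ENNReal.ofReal (8 * c * (A (t (k + 1)) * C.kFun f (t (k + 1)))) +
        if k = 0 then ENNReal.ofReal (3 * a 1 * ‖z‖) else 0 := fun k => by
    rcases lt_trichotomy k 0 with hk | rfl | hk
    · rw [if_neg hk.ne, add_zero]
      refine ENNReal.ofReal_le_ofReal ?_
      have h1 := C.max_norm_sub_le_four_mul_kFun (ht k) (htm (by lia)) (hle k) (hle (k + 1))
      have h3 := hpos _ (ht k)
      rw [← haA (t k) (ht k) (ht0 ▸ htm hk.le)]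
      simp only [hx', hy', if_pos hk.le, if_pos (by lia : k + 1 ≤ 0)]
      calc _ ≤ A (t k) * (4 * C.kFun f (t (k + 1))) := by gcongr
        _ = _ := by rw [hAt k]; ring
    · rw [if_pos rfl]
      refine le_add_left (ENNReal.ofReal_le_ofReal ?_)
      have h1 := hle 0
      have h3 := hl.trans_le (hal 1 one_pos)
      have h4 := C.kFun_incl₀_le z zero_le_one
      simp only [hx', hy', ht0, le_refl, if_true, if_neg (by lia : ¬ (0 : ℤ) + 1 ≤ 0), sub_zero,
        one_mul] at h1 ⊢
      -- The jump to the trivial splitting, at t_0 = 1: ‖x_0‖ + ‖y_0‖ ≤ 2K(f,1) ≤ 2‖z‖.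
      have h5 : max ‖z - x 0‖ ‖y 0‖ ≤ 3 * ‖z‖ := by
        refine max_le ((norm_sub_le _ _).trans ?_) ?_ <;>
          linarith [norm_nonneg (x 0), norm_nonneg (y 0), norm_nonneg z]
      calc _ ≤ a 1 * (3 * ‖z‖) := by gcongr
        _ = _ := by ring
    · simp [hx', hy', if_neg (not_le.2 hk), if_neg (by lia : ¬ k + 1 ≤ 0)]
  calc C.jNorm 0 1 a f ≤ _ := C.jNorm_le_two_mul_tsum_diffInter ha hl
        (fun s hs => (mul_le_of_le_one_right hl.le (min_le_left _ _)).trans (hal s hs))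
        ht h2 hxy' hx hy
    _ ≤ 2 * ∑' k, (ENNReal.ofReal (8 * c * (A (t (k + 1)) * C.kFun f (t (k + 1)))) +
          if k = 0 then ENNReal.ofReal (3 * a 1 * ‖z‖) else 0) := by
        gcongr with k
        exact hterm k
    _ ≤ 2 * (ENNReal.ofReal (8 * c) * (2 * C.kNorm 0 1 B f) +
          ENNReal.ofReal (3 * a 1 * ‖z‖)) := by
        rw [ENNReal.tsum_add, tsum_ite_eq,
          tsum_ofReal_mul_succ (g := fun k => A (t k) * C.kFun f (t k)) (by positivity)]
        gcongr
    _ = _ := by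
        have h3 := hl.trans_le (hal 1 one_pos)
        have e1 : 32 * c = 2 * (8 * c) * 2 := by ring
        have e2 : 6 * a 1 = 2 * (3 * a 1) := by ring
        rw [e1, e2, ENNReal.ofReal_mul' two_pos.le, ENNReal.ofReal_mul two_pos.le,
          ENNReal.ofReal_mul two_pos.le, ENNReal.ofReal_mul' (norm_nonneg z), ofReal_norm,
          ENNReal.ofReal_ofNat]
        ring

end Decomposition

end CompatibleCouple

/-! ### Slow variation, properties of A, and conclusion -/

theorem Coincide.of_le {V : Type*} {N M : V → ℝ≥0∞} {c C : ℝ} (hc : 0 < c) (hC : 0 < C)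
    (hNM : ∀ f, N f ≤ ENNReal.ofReal c * M f) (hMN : ∀ f, M f ≤ ENNReal.ofReal C * N f) :
    Coincide N M := by
  refine ⟨?_, c⁻¹, C, by positivity, hC, fun f _ => ⟨?_, hMN f⟩⟩
  · ext f
    exact ⟨fun h => (hMN f).trans_lt (ENNReal.mul_lt_top ENNReal.ofReal_lt_top h),
      fun h => (hNM f).trans_lt (ENNReal.mul_lt_top ENNReal.ofReal_lt_top h)⟩
  · calc ENNReal.ofReal c⁻¹ * N f ≤ ENNReal.ofReal c⁻¹ * (ENNReal.ofReal c * M f) := by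
          gcongr; exact hNM f
      _ = M f := by
          rw [← mul_assoc, ← ENNReal.ofReal_mul (by positivity), inv_mul_cancel₀ hc.ne',
            ENNReal.ofReal_one, one_mul]

/-- The almost-monotonicity of t^ε·b(t) at ε = 1/2, with the auxiliary monotone function eliminated.
-/
theorem SlowlyVarying.exists_sqrt_mul_le {b : ℝ → ℝ} (hb : SlowlyVarying b) :
    ∃ c, ∀ r s, 0 < r → r ≤ s → √r * b r ≤ c * (√s * b s) := by
  obtain ⟨g, hg, c, C, hc, hC, h⟩ := hb.equiv_monotone (1 / 2) (by norm_num)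
  simp only [← Real.sqrt_eq_rpow] at h
  refine ⟨C / c, fun r s hr hrs => ?_⟩
  have hs := hr.trans_le hrs
  calc √r * b r ≤ C * g r := (h r hr).2
    _ ≤ C * g s := by gcongr; exact hg hr hs hrs
    _ = C / c * (c * g s) := by field_simp
    _ ≤ C / c * (√s * b s) := mul_le_mul_of_nonneg_left (h s hs).1 (by positivity)

theorem LocallyAbsolutelyContinuous.continuousOn {f : ℝ → ℝ} (hf : LocallyAbsolutelyContinuous f) :
    ContinuousOn f (Ioi 0) := by
  intro x (hx : 0 < x)
  have h := (hf (x / 2) (2 * x) (by positivity) (by linarith)).continuousOn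
  rw [uIcc_of_le (by linarith)] at h
  exact (h.continuousAt (Icc_mem_nhds (by linarith) (by linarith))).continuousWithinAt

theorem le_of_antitoneOn_of_tendsto {a : ℝ → ℝ} (ha : AntitoneOn a (Ioi 0)) {l : ℝ}
    (hl : Tendsto a atTop (𝓝 l)) {s : ℝ} (hs : 0 < s) : l ≤ a s :=
  le_of_tendsto hl <| (eventually_ge_atTop s).mono fun _ hx => ha hs (hs.trans_le hx) hx

theorem corollary1p21 {X₀ X₁ E : Type*}
    [NormedAddCommGroup X₀] [NormedSpace ℝ X₀] [CompleteSpace X₀]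
    [NormedAddCommGroup X₁] [NormedSpace ℝ X₁] [CompleteSpace X₁]
    [AddCommGroup E] [Module ℝ E] [TopologicalSpace E] [IsTopologicalAddGroup E]
    [ContinuousSMul ℝ E] [T2Space E]
    (C : CompatibleCouple X₀ X₁ E)
    (a α A B : ℝ → ℝ) (c : ℝ)
    (ha_sv : SlowlyVarying a) (ha_ac : LocallyAbsolutelyContinuous a)
    (ha_anti : StrictAntiOn a (Ioi 0)) (ha_zero : Tendsto a (𝓝[>] 0) atTop)
    (ha_top : ∃ l : ℝ, 0 < l ∧ Tendsto a atTop (𝓝 l))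
    (hα_sv : SlowlyVarying α) (hα_ac : LocallyAbsolutelyContinuous α)
    (hα_anti : StrictAntiOn α (Ioi 0)) (hα_zero : Tendsto α (𝓝[>] 0) atTop)
    (hα_top : Tendsto α atTop (𝓝 0))
    (hc : 0 < c) (hA_ac : LocallyAbsolutelyContinuous A)
    (hA_le : ∀ x, 0 < x → x ≤ 1 → A x = a x)
    (hA_gt : ∀ x, 1 < x → A x = c * α x)
    (hB : ∀ᵐ x ∂(volume.restrict (Ioi (0 : ℝ))), B x = -(x * deriv A x)) :
    Coincide (C.jNorm 0 1 a) (C.interNorm₀ (C.jNorm 0 1 A)) ∧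
    Coincide (C.interNorm₀ (C.jNorm 0 1 A)) (C.interNorm₀ (C.kNorm 0 1 B)) := by
  have hcont := hA_ac.continuousOn
  -- The formula with α is assumed only for x > 1; continuity of A carries it to 1, where the two
  -- branches are glued.
  have hA_one : A 1 = c * α 1 := by
    have h1 : Tendsto A (𝓝[>] 1) (𝓝 (A 1)) :=
      (hcont.continuousAt (Ioi_mem_nhds one_pos)).tendsto.mono_left nhdsWithin_le_nhds
    have h2 : Tendsto (fun x => c * α x) (𝓝[>] 1) (𝓝 (c * α 1)) :=
      ((hα_ac.continuousOn.continuousAt (Ioi_mem_nhds one_pos)).tendsto.mono_left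
        nhdsWithin_le_nhds).const_mul c
    refine tendsto_nhds_unique h1 (h2.congr' ?_)
    filter_upwards [self_mem_nhdsWithin] with x hx using (hA_gt x hx).symm
  have hA_ge : ∀ x, 1 ≤ x → A x = c * α x := fun x hx => by
    rcases hx.eq_or_lt with rfl | hx
    · exact hA_one
    · exact hA_gt x hx
  have hpos : ∀ s, 0 < s → 0 < A s := fun s hs => by
    rcases le_total s 1 with h | h
    · rw [hA_le s hs h]; exact ha_sv.pos s hs
    · rw [hA_ge s h]; exact mul_pos hc (hα_sv.pos s hs)
  have hanti_le : ∀ x y, 0 < x → x < y → y ≤ 1 → A y < A x := fun x y hx hxy hy => by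
    rw [hA_le x hx (hxy.le.trans hy), hA_le y (hx.trans hxy) hy]
    exact ha_anti hx (hx.trans hxy) hxy
  have hanti_ge : ∀ x y, 1 ≤ x → x < y → A y < A x := fun x y hx hxy => by
    have hx0 : 0 < x := one_pos.trans_le hx
    rw [hA_ge x hx, hA_ge y (hx.trans hxy.le)]
    exact mul_lt_mul_of_pos_left (hα_anti hx0 (hx0.trans hxy) hxy) hc
  have hanti : StrictAntiOn A (Ioi 0) := fun x hx y hy hxy => by
    rcases le_or_gt y 1 with h | h
    · exact hanti_le x y hx hxy h
    · rcases lt_or_ge x 1 with h' | h'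
      · exact (hanti_ge 1 y le_rfl h).trans (hanti_le x 1 hx h' le_rfl)
      · exact hanti_ge x y h' hxy
  have h0 : Tendsto A (𝓝[>] 0) atTop := by
    refine ha_zero.congr' ?_
    filter_upwards [Ioc_mem_nhdsGT (one_pos : (0 : ℝ) < 1)] with x hx using (hA_le x hx.1 hx.2).symm
  have htop : Tendsto A atTop (𝓝 0) := by
    have h : Tendsto (fun x => c * α x) atTop (𝓝 0) := by simpa using hα_top.const_mul c
    refine h.congr' ?_
    filter_upwards [eventually_ge_atTop 1] with x hx using (hA_ge x hx).symm
  obtain ⟨ca, hca⟩ := ha_sv.exists_sqrt_mul_le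
  obtain ⟨cα, hcα⟩ := hα_sv.exists_sqrt_mul_le
  have hca1 := one_le_of_sqrt_mul_le ha_sv.pos hca
  have hcα1 := one_le_of_sqrt_mul_le hα_sv.pos hcα
  have hle : ∀ r s, 0 < r → r ≤ s → s ≤ 1 → √r * A r ≤ ca * (√s * A s) := fun r s hr hrs hs => by
    rw [hA_le r hr (hrs.trans hs), hA_le s (hr.trans_le hrs) hs]
    exact hca r s hr hrs
  have hge : ∀ r s, 1 ≤ r → r ≤ s → √r * A r ≤ cα * (√s * A s) := fun r s hr hrs => by
    rw [hA_ge r hr, hA_ge s (hr.trans hrs)]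
    nlinarith [hcα r s (one_pos.trans_le hr) hrs]
  -- When r ≤ 1 ≤ s, chain the two estimates through 1; otherwise the other constant is harmless,
  -- being at least 1.
  have hd : ∀ r s, 0 < r → r ≤ s → √r * A r ≤ ca * cα * (√s * A s) := fun r s hr hrs => by
    have hs := hr.trans_le hrs
    have hAs : 0 ≤ √s * A s := mul_nonneg (Real.sqrt_nonneg s) (hpos s hs).le
    rcases le_total s 1 with h | h
    · refine (hle r s hr hrs h).trans ?_
      gcongr
      exact le_mul_of_one_le_right (by linarith) hcα1
    · rcases le_total r 1 with h' | h'
      · calc √r * A r ≤ ca * (√1 * A 1) := hle r 1 hr h' le_rfl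
          _ ≤ ca * (cα * (√s * A s)) := mul_le_mul_of_nonneg_left (hge 1 s le_rfl h) (by linarith)
          _ = _ := by ring
      · refine (hge r s h' hrs).trans ?_
        gcongr
        exact le_mul_of_one_le_left (by linarith) hca1
  obtain ⟨l, hl, hal⟩ := ha_top
  have hla : ∀ s, 0 < s → l ≤ a s := fun s hs =>
    le_of_antitoneOn_of_tendsto ha_anti.antitoneOn hal hs
  set d := ca * cα with hd_def
  have hd0 : 0 < d := by positivity
  have ha1 := ha_sv.pos 1 one_pos
  have hnorm₀ : ∀ f, C.norm₀ f ≤ ENNReal.ofReal l⁻¹ * C.jNorm 0 1 a f := fun f =>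
    C.norm₀_le_mul_jNorm (by positivity)
      (fun s hs => by rw [← div_eq_inv_mul, one_le_div hl]; exact hla s hs) f
  have hAa : ∀ f, C.jNorm 0 1 A f ≤ ENNReal.ofReal (a 1 / l) * C.jNorm 0 1 a f := fun f => by
    refine C.jNorm_le_mul_jNorm (fun s hs => (hpos s hs).le) (fun s hs => (ha_sv.pos s hs).le)
      (by positivity) (fun s hs => ?_) f
    have has := ha_sv.pos s hs
    rcases le_total s 1 with h | h
    · rw [hA_le s hs h]
      exact le_mul_of_one_le_left has.le ((one_le_div hl).2 (hla 1 one_pos))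
    · calc A s ≤ A 1 := hanti.antitoneOn (mem_Ioi.2 one_pos) hs h
        _ = a 1 / l * l := by rw [hA_le 1 one_pos le_rfl]; field_simp
        _ ≤ a 1 / l * a s := by gcongr; exact hla s hs
  have hBA : ∀ f, C.kNorm 0 1 B f ≤ ENNReal.ofReal (2 * d) * C.jNorm 0 1 A f := fun f =>
    C.kNorm_le_mul_jNorm hanti.antitoneOn hA_ac (fun s hs => (hpos s hs).le) hd0 hd hB f
  -- Outside X₀ the intersection norms are ∞, so below f may be taken in X₀.
  have htop_mul : ∀ {r : ℝ} {N : C.Sum → ℝ≥0∞} {f : C.Sum}, 0 < r → C.norm₀ f = ∞ →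
      ENNReal.ofReal r * C.interNorm₀ N f = ∞ := fun hr hf => by
    rw [CompatibleCouple.interNorm₀, hf, max_eq_left le_top, ENNReal.mul_top (by simpa using hr)]
  refine ⟨Coincide.of_le (c := 32 * d * (2 * d) + 6 * a 1) (C := l⁻¹ + a 1 / l) (by positivity)
    (by positivity) (fun f => ?_) (fun f => ?_),
    Coincide.of_le (c := 1 + 32 * d) (C := 1 + 2 * d) (by positivity) (by positivity)
    (fun f => ?_) (fun f => ?_)⟩
  · by_cases hf : C.norm₀ f = ∞
    · rw [htop_mul (by positivity) hf]
      exact le_top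
    obtain ⟨z, rfl⟩ := C.exists_incl₀_eq_of_norm₀_ne_top hf
    -- Even the comparison of the two J-norms passes through the K-norm, whence the product 32d·2d.
    refine (C.jNorm_incl₀_le_add hanti hA_ac hcont hpos h0 htop hd hB ha_anti.antitoneOn hl hla
      hA_le z).trans ?_
    rw [← C.norm₀_incl₀, ENNReal.ofReal_add (by positivity) (by positivity), add_mul,
      ENNReal.ofReal_mul (p := 32 * d) (by positivity), mul_assoc (ENNReal.ofReal (32 * d))]
    gcongr
    · exact (hBA _).trans (mul_le_mul_right (le_max_right _ _) _)
    · exact le_max_left _ _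
  · rw [ENNReal.ofReal_add (by positivity) (by positivity), add_mul]
    exact max_le ((hnorm₀ f).trans le_self_add) ((hAa f).trans le_add_self)
  · by_cases hf : C.norm₀ f = ∞
    · rw [htop_mul (by positivity) hf]
      exact le_top
    obtain ⟨z, rfl⟩ := C.exists_incl₀_eq_of_norm₀_ne_top hf
    rw [ENNReal.ofReal_add (by positivity) (by positivity), add_mul, ENNReal.ofReal_one, one_mul]
    refine max_le ((le_max_left _ _).trans le_self_add) ?_
    refine (C.jNorm_incl₀_le_mul_kNorm hanti hA_ac hcont hpos h0 htop hd hB z).trans ?_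
    exact (mul_le_mul_right (le_max_right _ _) _).trans le_add_self
  · rw [ENNReal.ofReal_add (by positivity) (by positivity), add_mul, ENNReal.ofReal_one, one_mul]
    refine max_le ((le_max_left _ _).trans le_self_add) ((hBA f).trans ?_)
    exact (mul_le_mul_right (le_max_right _ _) _).trans le_add_self
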